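/- Let $(X,\omega)$ be a compact Kähler manifold of complex dimension $n$, with $\omega=\tfrac i2\sum g_{\bar kj}\,dz^j\wedge d\bar z^k$, let $L\to X$ be a holomorphic line bundle with $c_1(L)=[\omega]$ (so $L$ is ample), and let $E\to X$ be a holomorphic vector bundle of rank $\mathrm{rk}(E)$. Let $Td(X)$ be the harmonic representative, with respect to $\omega$, of the total Todd class of $X$, and $Td_j(X)$ its component of degree $2j$. For a Hermitian metric $H$ on $E$ with Chern curvature $F=\bar\partial(\partial H\,H^{-1})$ and an integer $k\ge 0$ put $$\mu=\Big[\exp\!\Big(\frac{i}{2\pi}F+k\omega I\Big)\,Td(X)\Big]^{(2n)},$$ the component of degree $2n$, an $\mathrm{End}(E)$-valued form. Write $\frac{n!}{\omega^n}\mu$ for the section $\nu$ of $\mathrm{End}(E)$ with $\mu=\nu\,\omega^n/n!$. Let $H(t)$, $0\le t<T$, be a smooth family of Hermitian metrics on $E$ solving the almost Hermitian–Einstein flow $$\dot h\,h^{-1}=-\frac{n!}{\omega^n}\,\mu+\frac{\chi(X,E\otimes L^k)}{\mathrm{rk}(E)}\,I,\qquad h(t)=H(t)H(0)^{-1},$$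 where $\chi(X,E\otimes L^k)=\sum_q(-1)^q\dim H^q(X,E\otimes L^k)$. Then for all $t\in[0,T)$ (with the one-sided derivative at $t=0$) $$\dot\mu=-\sum_{m=1}^{n}\sum_{l=0}^{m-1}\frac{1}{(m-1)!}\binom{m-1}{l}\,\frac{i}{2\pi}\,\Big[\omega^l\Big(\frac{i}{2\pi}F\Big)^{m-1-l}\,\bar\partial\partial_H\Big(\frac{n!}{\omega^n}\mu\Big)\,Td_{n-m}(X)\Big]_{(\mathrm{sym})}k^l .$$ Here $\partial_H$ is the $(1,0)$-part of the covariant derivative on $\mathrm{End}(E)$ of the Chern connection of $H$, and $[\;\cdot\;]_{(\mathrm{sym})}$ is the average of the products over all orders of the $\mathrm{End}(E)$-valued factors ($m-1-l$ factors $\frac i{2\pi}F$ and one factor $\bar\partial\partial_H(\frac{n!}{\omega^n}\mu)$). -/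

import Mathlib

open Bundle Manifold ContDiff TensorProduct

noncomputable section

namespace AHE

/-! ### Pointwise algebra of complex valued differential forms -/

/-- The coordinate space `ℂⁿ`, used as model space of complex manifolds. -/
abbrev Cn (n : ℕ) : Type := Fin n → ℂ

/-- The complexified cotangent space of a complex vector space `V`: real-linear maps `V → ℂ`. -/
abbrev Cotangent (V : Type*) [AddCommGroup V] [Module ℂ V] : Type _ := V →ₗ[ℝ] ℂ

/-- Complex valued alternating forms of all degrees on (the real vector space underlying) `V`.
The product is the wedge product. -/
abbrev Form (V : Type*) [AddCommGroup V] [Module ℂ V] : Type _ := ExteriorAlgebra ℂ (Cotangent V)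

/-- Pull-back of covectors along a complex linear map. -/
def pullCotangent {V W : Type*} [AddCommGroup V] [Module ℂ V] [AddCommGroup W] [Module ℂ W]
    (A : V →ₗ[ℂ] W) : Cotangent W →ₗ[ℂ] Cotangent V where
  toFun f := f ∘ₗ A.restrictScalars ℝ
  map_add' _ _ := rfl
  map_smul' _ _ := rfl

/-- Pull-back of forms along a complex linear map. -/
def pullForm {V W : Type*} [AddCommGroup V] [Module ℂ V] [AddCommGroup W] [Module ℂ W]
    (A : V →ₗ[ℂ] W) : Form W →ₐ[ℂ] Form V :=
  ExteriorAlgebra.map (pullCotangent A)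

variable {n : ℕ}

/-- The homogeneous component of degree `p` of a form. -/
def degreePart (p : ℕ) : Form (Cn n) →ₗ[ℂ] Form (Cn n) :=
  GradedAlgebra.proj (fun i : ℕ ↦ ⋀[ℂ]^i (Cotangent (Cn n))) p

/-- The covector `dzⱼ`. -/
def covZ (j : Fin n) : Cotangent (Cn n) where
  toFun v := v j
  map_add' _ _ := rfl
  map_smul' _ _ := rfl

/-- The covector `dz̄ⱼ`. -/
def covZbar (j : Fin n) : Cotangent (Cn n) where
  toFun v := (starRingEnd ℂ) (v j)
  map_add' v w := by simp
  map_smul' r v := by simp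

/-- `dzⱼ` as a `1`-form. -/
def dz (j : Fin n) : Form (Cn n) := ExteriorAlgebra.ι ℂ (covZ j)

/-- `dz̄ⱼ` as a `1`-form. -/
def dzbar (j : Fin n) : Form (Cn n) := ExteriorAlgebra.ι ℂ (covZbar j)

/-- The space `Λ^{0,q}` of forms of type `(0,q)` on `ℂⁿ`: the span of the `q`-fold products of the
`dz̄ⱼ`. -/
def antiholForms (n q : ℕ) : Submodule ℂ (Form (Cn n)) :=
  (Submodule.span ℂ (Set.range (dzbar (n := n)))) ^ q

/-- The standard real basis `e₁, …, eₙ, i e₁, …, i eₙ` of `ℂⁿ`. -/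
def realVec (a : Fin 2 × Fin n) : Cn n := Pi.single a.2 (if a.1 = 0 then 1 else Complex.I)

/-- The dual real coframe `dx₁, …, dxₙ, dy₁, …, dyₙ`. -/
def realCov (a : Fin 2 × Fin n) : Cotangent (Cn n) where
  toFun v := if a.1 = 0 then ((v a.2).re : ℂ) else ((v a.2).im : ℂ)
  map_add' v w := by split_ifs <;> simp
  map_smul' r v := by split_ifs <;> simp

/-- Evaluation of covectors at a vector. -/
def evalCov (v : Cn n) : Module.Dual ℂ (Cotangent (Cn n)) where
  toFun f := f v
  map_add' _ _ := rfl
  map_smul' _ _ := rfl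

/-- The value of the degree `2n` component of a form on the standard real basis of `ℂⁿ`:
the linear functional with `f₁ ∧ ⋯ ∧ f₂ₙ ↦ det (f_a (v_b))`. -/
def topCoeff (n : ℕ) : Form (Cn n) →ₗ[ℂ] ℂ :=
  ExteriorAlgebra.liftAlternating (Pi.single (2 * n)
    ((Matrix.detRowAlternating (n := Fin (2 * n)) (R := ℂ)).compLinearMap
      (LinearMap.pi fun b ↦ evalCov (realVec (finProdFinEquiv.symm b)))))

/-- The quotient of two top degree forms (a number): the ratio of their values on a basis. -/
def topQuot (a v : Form (Cn n)) : ℂ := topCoeff n a / topCoeff n v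

/-! ### Differential calculus on `ℂⁿ` -/

/-- `∂/∂zⱼ`. -/
def wirt (j : Fin n) (f : Cn n → ℂ) (z : Cn n) : ℂ :=
  (1 / 2) * (fderiv ℝ f z (Pi.single j 1) - Complex.I * fderiv ℝ f z (Pi.single j Complex.I))

/-- `∂/∂z̄ⱼ`. -/
def wirtBar (j : Fin n) (f : Cn n → ℂ) (z : Cn n) : ℂ :=
  (1 / 2) * (fderiv ℝ f z (Pi.single j 1) + Complex.I * fderiv ℝ f z (Pi.single j Complex.I))

/-- A basis of the space of forms on `ℂⁿ`. -/
def formBasis (n : ℕ) :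
    Module.Basis (Finset (Fin (Module.finrank ℂ (Cotangent (Cn n))))) ℂ (Form (Cn n)) :=
  (Module.finBasis ℂ (Cotangent (Cn n))).ExteriorAlgebra

/-- Apply a linear differential operator on functions to the coefficients of a form. -/
def coeffwise (D : (Cn n → ℂ) → Cn n → ℂ) (f : Cn n → Form (Cn n)) (z : Cn n) : Form (Cn n) :=
  ∑ s, D (fun w ↦ (formBasis n).repr (f w) s) z • formBasis n s

/-- Smoothness (`C^∞` in the real sense) of a form on a subset of `ℂⁿ`. -/
def FormSmoothOn (f : Cn n → Form (Cn n)) (U : Set (Cn n)) : Prop :=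
  ∀ l : Form (Cn n) →ₗ[ℂ] ℂ, ContDiffOn ℝ ∞ (fun z ↦ l (f z)) U

/-- The operator `∂̄` on forms, `f ↦ ∑ⱼ dz̄ⱼ ∧ ∂f/∂z̄ⱼ`. -/
def dbar (f : Cn n → Form (Cn n)) (z : Cn n) : Form (Cn n) :=
  ∑ j, dzbar j * coeffwise (wirtBar j) f z

/-- The exterior derivative `d = ∂ + ∂̄` on forms. -/
def extd (f : Cn n → Form (Cn n)) (z : Cn n) : Form (Cn n) :=
  ∑ j, dz j * coeffwise (wirt j) f z + dbar f z

/-! ### Forms on complex manifolds -/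

section Manifold

variable {X : Type*} [TopologicalSpace X] [ChartedSpace (Cn n) X]

/-- The holomorphic tangent spaces, as a family of complex vector spaces over `X`. -/
abbrev Tan (n : ℕ) (X : Type*) [TopologicalSpace X] [ChartedSpace (Cn n) X] : X → Type :=
  fun x ↦ TangentSpace 𝓘(ℂ, Cn n) x

/-- A (not necessarily continuous) differential form on `X`, of mixed degree. -/
abbrev FormField (n : ℕ) (X : Type*) [TopologicalSpace X] [ChartedSpace (Cn n) X] : Type _ :=
  ∀ x : X, Form (Tan n X x)

/-- The differential of the inverse of a chart. -/
def chartDiff (c : OpenPartialHomeomorph X (Cn n)) (z : Cn n) : Cn n →ₗ[ℂ] Tan n X (c.symm z) :=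
  (mfderiv 𝓘(ℂ, Cn n) 𝓘(ℂ, Cn n) c.symm z).toLinearMap

/-- The expression of a form on `X` in a chart. -/
def inChart (c : OpenPartialHomeomorph X (Cn n)) (α : FormField n X) (z : Cn n) : Form (Cn n) :=
  pullForm (chartDiff c z) (α (c.symm z))

/-- Smooth forms. -/
def IsSmoothForm (α : FormField n X) : Prop :=
  ∀ c ∈ atlas (Cn n) X, FormSmoothOn (inChart c α) c.target

/-- Closed forms. -/
def IsClosedForm (α : FormField n X) : Prop :=
  ∀ c ∈ atlas (Cn n) X, ∀ z ∈ c.target, extd (inChart c α) z = 0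

/-! ### Hermitian metrics, curvature -/

section Bundle

variable {r : ℕ} {E : X → Type*} [∀ x, AddCommGroup (E x)] [∀ x, Module ℂ (E x)]
  [∀ x, TopologicalSpace (E x)] [TopologicalSpace (TotalSpace (Cn r) E)] [FiberBundle (Cn r) E]

/-- The part of the range of the chart `c` over which the local frame given by `τ` lives. -/
def dom {n r : ℕ} {X : Type*} [TopologicalSpace X] {E : X → Type*}
    [TopologicalSpace (TotalSpace (Cn r) E)] (c : OpenPartialHomeomorph X (Cn n))
    (τ : Trivialization (Cn r) (π (Cn r) E)) : Set (Cn n) :=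
  c.target ∩ c.symm ⁻¹' τ.baseSet

/-- The `α`-th vector of the local frame `e₁, …, e_r` given by the trivialization `τ`. -/
def frame (τ : Trivialization (Cn r) (π (Cn r) E)) (x : X) (α : Fin r) : E x :=
  τ.symm x (Pi.single α 1)

/-- The matrix `H_{αβ} = ⟨e_α, e_β⟩` of a family of sesquilinear forms (antilinear in the first
argument of `H`) in a local frame and a chart. The matrix element is linear in `e_α`,
antilinear in `e_β`. -/
def gram (H : ∀ x, E x →ₗ⋆[ℂ] E x →ₗ[ℂ] ℂ) (c : OpenPartialHomeomorph X (Cn n))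
    (τ : Trivialization (Cn r) (π (Cn r) E)) (z : Cn n) : Matrix (Fin r) (Fin r) ℂ :=
  Matrix.of fun α β ↦ H (c.symm z) (frame τ (c.symm z) β) (frame τ (c.symm z) α)

variable (n r E) in
/-- A smooth Hermitian metric on the bundle `E`. -/
structure HermitianMetric where
  /-- the metric at the points of `X`, antilinear in the first and linear in the second argument -/
  inner : ∀ x, E x →ₗ⋆[ℂ] E x →ₗ[ℂ] ℂ
  conj_symm : ∀ x u v, (starRingEnd ℂ) (inner x u v) = inner x v u
  pos : ∀ x u, u ≠ 0 → 0 < (inner x u u).re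
  smooth : ∀ c ∈ atlas (Cn n) X, ∀ (τ : Trivialization (Cn r) (π (Cn r) E))
    [MemTrivializationAtlas τ], ∀ α β,
      ContDiffOn ℝ ∞ (fun z ↦ gram inner c τ z α β) (dom c τ)

end Bundle

/-! In a holomorphic frame `e = (e_α)` over a chart, an endomorphism `Φ` of the bundle is represented
by the matrix with `Φ e_α = ∑_β Φ_{αβ} e_β`, a metric by the matrix `H_{αβ} = ⟨e_α, e_β⟩`, and the
Chern connection by the matrix `∂H H⁻¹` of `(1,0)`-forms, `D e_α = ∑_β (∂H H⁻¹)_{αβ} e_β`. -/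

variable {r : ℕ}

/-- The coefficient `Aⱼ = (∂ⱼH) H⁻¹` of `dzⱼ` in the Chern connection of the metric with local
matrix `H`. -/
def connCoeff (H : Cn n → Matrix (Fin r) (Fin r) ℂ) (j : Fin n) (z : Cn n) :
    Matrix (Fin r) (Fin r) ℂ :=
  (Matrix.of fun α β ↦ wirt j (fun w ↦ H w α β) z) * (H z)⁻¹

/-- The curvature `F = ∂̄(∂H H⁻¹) = ∑ⱼₖ ∂Aⱼ/∂z̄ₖ dz̄ₖ ∧ dzⱼ` of the metric with local matrix `H`. -/
def curvature (H : Cn n → Matrix (Fin r) (Fin r) ℂ) (z : Cn n) :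
    Matrix (Fin r) (Fin r) (Form (Cn n)) :=
  Matrix.of fun α β ↦ ∑ j, ∑ k,
    wirtBar k (fun w ↦ connCoeff H j w α β) z • (dzbar k * dz j)

/-- The coefficient of `dzⱼ` in `∂_H Φ`, the `(1,0)`-part of the covariant derivative of an
endomorphism `Φ`, namely `∂ⱼΦ + Φ Aⱼ - Aⱼ Φ`. -/
def covDerivCoeff (H Φ : Cn n → Matrix (Fin r) (Fin r) ℂ) (j : Fin n) (z : Cn n) :
    Matrix (Fin r) (Fin r) ℂ :=
  (Matrix.of fun α β ↦ wirt j (fun w ↦ Φ w α β) z) + Φ z * connCoeff H j z - connCoeff H j z * Φ z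

/-- The `End(E)`-valued `(1,1)`-form `∂̄ ∂_H Φ`. -/
def dbarDH (H Φ : Cn n → Matrix (Fin r) (Fin r) ℂ) (z : Cn n) :
    Matrix (Fin r) (Fin r) (Form (Cn n)) :=
  Matrix.of fun α β ↦ ∑ j, ∑ k,
    wirtBar k (fun w ↦ covDerivCoeff H Φ j w α β) z • (dzbar k * dz j)

/-! ### Kähler metrics -/

section Kahler

variable [IsManifold 𝓘(ℂ, Cn n) 1 X]

/-- The matrix of a metric on the tangent bundle with respect to vectors `u`, `v` in a chart. -/
def chartInner (g : HermitianMetric n n (Tan n X)) (c : OpenPartialHomeomorph X (Cn n))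
    (u v : Cn n) (z : Cn n) : ℂ :=
  g.inner (c.symm z) (chartDiff c z u) (chartDiff c z v)

/-- The fundamental form `(i/2) ∑ⱼₖ g_{k̄j} dzⱼ ∧ dz̄ₖ` in a chart. -/
def kahlerForm (g : HermitianMetric n n (Tan n X)) (c : OpenPartialHomeomorph X (Cn n))
    (z : Cn n) : Form (Cn n) :=
  ∑ j, ∑ k, (Complex.I / 2 * chartInner g c (Pi.single k 1) (Pi.single j 1) z) • (dz j * dzbar k)

/-- The volume form `ωⁿ / n!` in a chart. -/
def volForm (g : HermitianMetric n n (Tan n X)) (c : OpenPartialHomeomorph X (Cn n))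
    (z : Cn n) : Form (Cn n) :=
  ((n.factorial : ℂ)⁻¹) • kahlerForm g c z ^ n

/-- A Hermitian metric on the tangent bundle is Kähler if its fundamental form is closed. -/
def IsKahler (g : HermitianMetric n n (Tan n X)) : Prop :=
  ∀ c ∈ atlas (Cn n) X, ∀ z ∈ c.target, extd (kahlerForm g c) z = 0

/-- The matrix of the underlying Riemannian metric `Re g` in real chart coordinates. -/
def riemMatrix (g : HermitianMetric n n (Tan n X)) (c : OpenPartialHomeomorph X (Cn n))
    (z : Cn n) : Matrix (Fin 2 × Fin n) (Fin 2 × Fin n) ℝ :=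
  Matrix.of fun a b ↦ (chartInner g c (realVec a) (realVec b) z).re

/-- Raising of the index of a covector in real chart coordinates, `ξ_a ↦ ∑_a G^{ab} ξ_a`;
the vector `∂_b` is written as the covector `dx_b`. -/
def raiseIndex (g : HermitianMetric n n (Tan n X)) (c : OpenPartialHomeomorph X (Cn n))
    (z : Cn n) : Cotangent (Cn n) →ₗ[ℂ] Cotangent (Cn n) :=
  ∑ a, ∑ b, ((riemMatrix g c z)⁻¹ a b : ℂ) •
    (evalCov (realVec a)).smulRight (realCov b)

/-- Coclosed forms. In a chart with coordinates `x_a`, a form `α` is coclosed if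
`∑_a ∂_a (√(det G) α^{a a₂ … a_p}) = 0` for all `a₂, …, a_p`, where `α^{a₁ … a_p}` is obtained
from `α` by raising all indices. -/
def IsCoclosedForm (g : HermitianMetric n n (Tan n X)) (α : FormField n X) : Prop :=
  ∀ c ∈ atlas (Cn n) X, ∀ z ∈ c.target,
    ∑ a : Fin 2 × Fin n, CliffordAlgebra.contractLeft (Q := (0 : QuadraticForm ℂ (Cotangent (Cn n))))
      (evalCov (realVec a))
      (coeffwise (fun f w ↦ fderiv ℝ f w (realVec a))
        (fun w ↦ (Real.sqrt (riemMatrix g c w).det : ℂ) •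
          ExteriorAlgebra.map (raiseIndex g c w) (inChart c α w)) z) = 0

/-! ### Todd class -/

/-- The Leibniz formula for the determinant of a matrix of even (hence commuting) forms. -/
def leibnizDet (M : Matrix (Fin r) (Fin r) (Form (Cn n))) : Form (Cn n) :=
  ∑ σ : Equiv.Perm (Fin r), ((Equiv.Perm.sign σ : ℤ) : ℂ) • (List.ofFn fun i ↦ M (σ i) i).prod

/-- The total Todd form `det (x / (1 - e^{-x}))` at `x = (i/2π) R`, for a matrix `R` of `2`-forms.
Here `x / (1 - e^{-x}) = ∑ⱼ Bⱼ xʲ / j!` with `B₁ = 1/2`; powers with `j > n` vanish. -/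
def toddOf (R : Matrix (Fin r) (Fin r) (Form (Cn n))) : Form (Cn n) :=
  leibnizDet (∑ j ∈ Finset.range (n + 1),
    (((bernoulli' j : ℚ) : ℂ) / (j.factorial : ℂ)) •
      ((Complex.I / (2 * (Real.pi : ℂ))) • R) ^ j)

/-- `Td` is the harmonic representative, with respect to the metric `g`, of the total Todd class
of `X`: it is smooth, closed and coclosed, and it differs by an exact form from
the Todd form of the curvature of the tangent bundle with the metric `g`. -/
structure IsHarmonicTodd (g : HermitianMetric n n (Tan n X))
    (Td : FormField n X) : Prop where
  smooth : IsSmoothForm Td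
  closed : IsClosedForm Td
  coclosed : IsCoclosedForm g Td
  todd_class : ∃ β : FormField n X, IsSmoothForm β ∧
    ∀ c ∈ atlas (Cn n) X, ∀ (τ : Trivialization (Cn n) (π (Cn n) (Tan n X)))
      [MemTrivializationAtlas τ], ∀ z ∈ dom c τ,
        inChart c Td z = toddOf (curvature (gram g.inner c τ) z) + extd (inChart c β) z

/-! ### The polarization -/

section LineBundle

variable {L : X → Type*} [∀ x, AddCommGroup (L x)] [∀ x, Module ℂ (L x)]
  [∀ x, TopologicalSpace (L x)] [TopologicalSpace (TotalSpace (Cn 1) L)] [FiberBundle (Cn 1) L]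

variable (L) in
/-- `c₁(L) = [ω]` in de Rham cohomology: for some Hermitian metric on `L` with curvature `F_L`, the
form `(i/2π) F_L - ω` is exact. -/
def ChernClassEq (g : HermitianMetric n n (Tan n X)) : Prop :=
  ∃ (hL : HermitianMetric n 1 L) (β : FormField n X), IsSmoothForm β ∧
    ∀ c ∈ atlas (Cn n) X, ∀ (σ : Trivialization (Cn 1) (π (Cn 1) L))
      [MemTrivializationAtlas σ], ∀ z ∈ dom c σ,
        (Complex.I / (2 * (Real.pi : ℂ))) • curvature (gram hL.inner c σ) z 0 0 =
          kahlerForm g c z + extd (inChart c β) z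

end LineBundle

end Kahler

/-! ### The Euler characteristic of `E ⊗ L^k`, through Dolbeault cohomology -/

section Dolbeault

theorem isOpen_dom_inter {n r : ℕ} {X : Type*} [TopologicalSpace X]
    {E : X → Type*} [TopologicalSpace (TotalSpace (Cn r) E)]
    {L : X → Type*} [TopologicalSpace (TotalSpace (Cn 1) L)] (c : OpenPartialHomeomorph X (Cn n))
    (τ : Trivialization (Cn r) (π (Cn r) E)) (σ : Trivialization (Cn 1) (π (Cn 1) L)) :
    IsOpen (dom c τ ∩ dom c σ) :=
  (c.symm.isOpen_inter_preimage τ.open_baseSet).inter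
    (c.symm.isOpen_inter_preimage σ.open_baseSet)

variable (E : X → Type*) [∀ x, AddCommGroup (E x)] [∀ x, Module ℂ (E x)]
  [∀ x, TopologicalSpace (E x)] [TopologicalSpace (TotalSpace (Cn r) E)] [FiberBundle (Cn r) E]
  [VectorBundle ℂ (Cn r) E]
  (L : X → Type*) [∀ x, AddCommGroup (L x)] [∀ x, Module ℂ (L x)]
  [∀ x, TopologicalSpace (L x)] [TopologicalSpace (TotalSpace (Cn 1) L)] [FiberBundle (Cn 1) L]
  [VectorBundle ℂ (Cn 1) L]

/-- The fibre of `E ⊗ L^k`. -/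
abbrev Twist (k : ℕ) (x : X) : Type _ := E x ⊗[ℂ] (⨂[ℂ]^k (L x))

/-- (Not necessarily continuous) forms on `X` with values in `E ⊗ L^k`. -/
def TwistForm (n : ℕ) {X : Type*} [TopologicalSpace X] [ChartedSpace (Cn n) X]
    (E : X → Type*) [∀ x, AddCommGroup (E x)] [∀ x, Module ℂ (E x)]
    (L : X → Type*) [∀ x, AddCommGroup (L x)] [∀ x, Module ℂ (L x)] (k : ℕ) : Type _ :=
  ∀ x : X, Form (Tan n X x) ⊗[ℂ] Twist E L k x

instance (n : ℕ) {X : Type*} [TopologicalSpace X] [ChartedSpace (Cn n) X]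
    (E : X → Type*) [∀ x, AddCommGroup (E x)] [∀ x, Module ℂ (E x)]
    (L : X → Type*) [∀ x, AddCommGroup (L x)] [∀ x, Module ℂ (L x)] (k : ℕ) :
    AddCommGroup (TwistForm n E L k) :=
  inferInstanceAs (AddCommGroup (∀ x : X, Form (Tan n X x) ⊗[ℂ] Twist E L k x))

instance (n : ℕ) {X : Type*} [TopologicalSpace X] [ChartedSpace (Cn n) X]
    (E : X → Type*) [∀ x, AddCommGroup (E x)] [∀ x, Module ℂ (E x)]
    (L : X → Type*) [∀ x, AddCommGroup (L x)] [∀ x, Module ℂ (L x)] (k : ℕ) :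
    Module ℂ (TwistForm n E L k) :=
  inferInstanceAs (Module ℂ (∀ x : X, Form (Tan n X x) ⊗[ℂ] Twist E L k x))

/-- The value of a form with values in `E ⊗ L^k` at a point. -/
def twistEval (n : ℕ) {X : Type*} [TopologicalSpace X] [ChartedSpace (Cn n) X]
    (E : X → Type*) [∀ x, AddCommGroup (E x)] [∀ x, Module ℂ (E x)]
    (L : X → Type*) [∀ x, AddCommGroup (L x)] [∀ x, Module ℂ (L x)] (k : ℕ) (x : X) :
    TwistForm n E L k →ₗ[ℂ] Form (Tan n X x) ⊗[ℂ] Twist E L k x where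
  toFun ψ := ψ x
  map_add' _ _ := rfl
  map_smul' _ _ := rfl

variable {E L}

/-- The `α`-th coordinate on the fibre of `E ⊗ L^k` given by trivializations `τ` of `E` and `σ`
of `L`: `u ⊗ l₁ ⊗ ⋯ ⊗ l_k ↦ τ(u)_α σ(l₁) ⋯ σ(l_k)`. -/
def twistCoord (k : ℕ) (τ : Trivialization (Cn r) (π (Cn r) E)) [MemTrivializationAtlas τ]
    (σ : Trivialization (Cn 1) (π (Cn 1) L)) [MemTrivializationAtlas σ] (x : X) (α : Fin r) :
    Twist E L k x →ₗ[ℂ] ℂ :=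
  LinearMap.mul' ℂ ℂ ∘ₗ TensorProduct.map
    (LinearMap.proj α ∘ₗ τ.linearMapAt ℂ x)
    (PiTensorProduct.lift ((MultilinearMap.mkPiAlgebra ℂ (Fin k) ℂ).compLinearMap
      fun _ ↦ LinearMap.proj (0 : Fin 1) ∘ₗ σ.linearMapAt ℂ x))

/-- The `α`-th component of an `E ⊗ L^k`-valued form in a chart and trivializations. -/
def twistComp (k : ℕ) (c : OpenPartialHomeomorph X (Cn n))
    (τ : Trivialization (Cn r) (π (Cn r) E)) [MemTrivializationAtlas τ]
    (σ : Trivialization (Cn 1) (π (Cn 1) L)) [MemTrivializationAtlas σ]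
    (α : Fin r) (z : Cn n) : TwistForm n E L k →ₗ[ℂ] Form (Cn n) :=
  (TensorProduct.rid ℂ (Form (Cn n))).toLinearMap ∘ₗ
    TensorProduct.map (pullForm (chartDiff c z)).toLinearMap
      (twistCoord k τ σ (c.symm z) α) ∘ₗ twistEval n E L k (c.symm z)

theorem coeffwise_add {D : (Cn n → ℂ) → Cn n → ℂ} {f g : Cn n → Form (Cn n)} {z : Cn n}
    (h : ∀ l : Form (Cn n) →ₗ[ℂ] ℂ, D (fun w ↦ l (f w) + l (g w)) z
      = D (fun w ↦ l (f w)) z + D (fun w ↦ l (g w)) z) :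
    coeffwise D (fun w ↦ f w + g w) z = coeffwise D f z + coeffwise D g z := by
  unfold coeffwise
  rw [← Finset.sum_add_distrib]
  refine Finset.sum_congr rfl fun s _ ↦ ?_
  rw [← add_smul]
  congr 1
  have := h ((formBasis n).coord s)
  simpa using this

theorem coeffwise_smul {D : (Cn n → ℂ) → Cn n → ℂ} {f : Cn n → Form (Cn n)} {z : Cn n} (a : ℂ)
    (h : ∀ l : Form (Cn n) →ₗ[ℂ] ℂ, D (fun w ↦ a * l (f w)) z = a * D (fun w ↦ l (f w)) z) :
    coeffwise D (fun w ↦ a • f w) z = a • coeffwise D f z := by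
  unfold coeffwise
  rw [Finset.smul_sum]
  refine Finset.sum_congr rfl fun s _ ↦ ?_
  rw [smul_smul]
  congr 1
  have := h ((formBasis n).coord s)
  simpa using this

theorem dbar_add {f g : Cn n → Form (Cn n)} {U : Set (Cn n)} (hU : IsOpen U)
    (hf : FormSmoothOn f U) (hg : FormSmoothOn g U) {z : Cn n} (hz : z ∈ U) :
    dbar (fun w ↦ f w + g w) z = dbar f z + dbar g z := by
  unfold dbar
  rw [← Finset.sum_add_distrib]
  refine Finset.sum_congr rfl fun j _ ↦ ?_
  rw [← mul_add, coeffwise_add]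
  intro l
  have h1 := ((hf l).contDiffAt (hU.mem_nhds hz)).differentiableAt (by simp)
  have h2 := ((hg l).contDiffAt (hU.mem_nhds hz)).differentiableAt (by simp)
  simp only [wirtBar]
  rw [fderiv_fun_add h1 h2]
  simp only [add_apply]
  ring

theorem dbar_smul {f : Cn n → Form (Cn n)} {U : Set (Cn n)} (hU : IsOpen U)
    (hf : FormSmoothOn f U) (a : ℂ) {z : Cn n} (hz : z ∈ U) :
    dbar (fun w ↦ a • f w) z = a • dbar f z := by
  unfold dbar
  rw [Finset.smul_sum]
  refine Finset.sum_congr rfl fun j _ ↦ ?_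
  rw [← mul_smul_comm, coeffwise_smul]
  intro l
  have h1 := ((hf l).contDiffAt (hU.mem_nhds hz)).differentiableAt (by simp)
  simp only [wirtBar]
  rw [fderiv_const_mul h1]
  simp only [smul_apply, smul_eq_mul]
  ring

/-- The space `A^{0,q}(X, E ⊗ L^k)` of smooth `(0,q)`-forms with values in `E ⊗ L^k`. -/
def twistForms (n r : ℕ) {X : Type*} [TopologicalSpace X] [ChartedSpace (Cn n) X]
    (E : X → Type*) [∀ x, AddCommGroup (E x)] [∀ x, Module ℂ (E x)]
    [∀ x, TopologicalSpace (E x)] [TopologicalSpace (TotalSpace (Cn r) E)] [FiberBundle (Cn r) E]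
    [VectorBundle ℂ (Cn r) E]
    (L : X → Type*) [∀ x, AddCommGroup (L x)] [∀ x, Module ℂ (L x)]
    [∀ x, TopologicalSpace (L x)] [TopologicalSpace (TotalSpace (Cn 1) L)] [FiberBundle (Cn 1) L]
    [VectorBundle ℂ (Cn 1) L] (k q : ℕ) : Submodule ℂ (TwistForm n E L k) where
  carrier := {ψ | ∀ c ∈ atlas (Cn n) X, ∀ (τ : Trivialization (Cn r) (π (Cn r) E))
    [MemTrivializationAtlas τ] (σ : Trivialization (Cn 1) (π (Cn 1) L))
    [MemTrivializationAtlas σ] (α : Fin r),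
      FormSmoothOn (fun z ↦ twistComp k c τ σ α z ψ) (dom c τ ∩ dom c σ) ∧
      ∀ z ∈ dom c τ ∩ dom c σ, twistComp k c τ σ α z ψ ∈ antiholForms n q}
  add_mem' {ψ φ} hψ hφ := by
    intro c hc τ _ σ _ α
    refine ⟨fun l ↦ ?_, fun z hz ↦ ?_⟩
    · simp only [map_add]
      exact ((hψ c hc τ σ α).1 l).add ((hφ c hc τ σ α).1 l)
    · rw [map_add]
      exact add_mem ((hψ c hc τ σ α).2 z hz) ((hφ c hc τ σ α).2 z hz)
  zero_mem' := by
    intro c hc τ _ σ _ α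
    refine ⟨fun l ↦ ?_, fun z hz ↦ ?_⟩
    · simp only [map_zero]
      exact contDiffOn_const
    · rw [map_zero]
      exact zero_mem _
  smul_mem' a ψ hψ := by
    intro c hc τ _ σ _ α
    refine ⟨fun l ↦ ?_, fun z hz ↦ ?_⟩
    · simp only [map_smul, smul_eq_mul]
      exact contDiffOn_const.mul ((hψ c hc τ σ α).1 l)
    · rw [map_smul]
      exact Submodule.smul_mem _ _ ((hψ c hc τ σ α).2 z hz)

/-- The relation `∂̄ψ = φ` between smooth `(0,q)`-forms with values in `E ⊗ L^k`
and `(0,q+1)`-forms, as a subspace of pairs `(ψ, φ)`; `∂̄` acts on the components in holomorphic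
frames. -/
def dbarGraph (n r : ℕ) {X : Type*} [TopologicalSpace X] [ChartedSpace (Cn n) X]
    (E : X → Type*) [∀ x, AddCommGroup (E x)] [∀ x, Module ℂ (E x)]
    [∀ x, TopologicalSpace (E x)] [TopologicalSpace (TotalSpace (Cn r) E)] [FiberBundle (Cn r) E]
    [VectorBundle ℂ (Cn r) E]
    (L : X → Type*) [∀ x, AddCommGroup (L x)] [∀ x, Module ℂ (L x)]
    [∀ x, TopologicalSpace (L x)] [TopologicalSpace (TotalSpace (Cn 1) L)] [FiberBundle (Cn 1) L]
    [VectorBundle ℂ (Cn 1) L] (k q : ℕ) :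
    Submodule ℂ (TwistForm n E L k × TwistForm n E L k) where
  carrier := {p | p.1 ∈ twistForms n r E L k q ∧
    ∀ c ∈ atlas (Cn n) X, ∀ (τ : Trivialization (Cn r) (π (Cn r) E))
    [MemTrivializationAtlas τ] (σ : Trivialization (Cn 1) (π (Cn 1) L))
    [MemTrivializationAtlas σ] (α : Fin r), ∀ z ∈ dom c τ ∩ dom c σ,
      dbar (fun w ↦ twistComp k c τ σ α w p.1) z = twistComp k c τ σ α z p.2}
  add_mem' {p p'} hp hp' := by
    refine ⟨add_mem hp.1 hp'.1, ?_⟩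
    intro c hc τ _ σ _ α z hz
    simp only [Prod.fst_add, Prod.snd_add, map_add]
    rw [dbar_add (isOpen_dom_inter c τ σ) (hp.1 c hc τ σ α).1 (hp'.1 c hc τ σ α).1 hz,
      hp.2 c hc τ σ α z hz, hp'.2 c hc τ σ α z hz]
  zero_mem' := by
    refine ⟨zero_mem _, ?_⟩
    intro c hc τ _ σ _ α z hz
    have := dbar_smul (isOpen_dom_inter c τ σ)
      ((zero_mem (twistForms n r E L k q) : (0 : TwistForm n E L k) ∈ _) c hc τ σ α).1 0 hz
    simpa using this
  smul_mem' a p hp := by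
    refine ⟨Submodule.smul_mem _ a hp.1, ?_⟩
    intro c hc τ _ σ _ α z hz
    simp only [Prod.smul_fst, Prod.smul_snd, map_smul]
    rw [dbar_smul (isOpen_dom_inter c τ σ) (hp.1 c hc τ σ α).1 a hz, hp.2 c hc τ σ α z hz]

/-- The space of `∂̄`-closed smooth `(0,q)`-forms with values in `E ⊗ L^k`. -/
def dbarCycles (n r : ℕ) {X : Type*} [TopologicalSpace X] [ChartedSpace (Cn n) X]
    (E : X → Type*) [∀ x, AddCommGroup (E x)] [∀ x, Module ℂ (E x)]
    [∀ x, TopologicalSpace (E x)] [TopologicalSpace (TotalSpace (Cn r) E)] [FiberBundle (Cn r) E]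
    [VectorBundle ℂ (Cn r) E]
    (L : X → Type*) [∀ x, AddCommGroup (L x)] [∀ x, Module ℂ (L x)]
    [∀ x, TopologicalSpace (L x)] [TopologicalSpace (TotalSpace (Cn 1) L)] [FiberBundle (Cn 1) L]
    [VectorBundle ℂ (Cn 1) L] (k q : ℕ) : Submodule ℂ (TwistForm n E L k) :=
  (dbarGraph n r E L k q).comap (LinearMap.inl ℂ _ _)

/-- The space of `∂̄`-exact smooth `(0,q)`-forms with values in `E ⊗ L^k`. -/
def dbarBoundaries (n r : ℕ) {X : Type*} [TopologicalSpace X] [ChartedSpace (Cn n) X]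
    (E : X → Type*) [∀ x, AddCommGroup (E x)] [∀ x, Module ℂ (E x)]
    [∀ x, TopologicalSpace (E x)] [TopologicalSpace (TotalSpace (Cn r) E)] [FiberBundle (Cn r) E]
    [VectorBundle ℂ (Cn r) E]
    (L : X → Type*) [∀ x, AddCommGroup (L x)] [∀ x, Module ℂ (L x)]
    [∀ x, TopologicalSpace (L x)] [TopologicalSpace (TotalSpace (Cn 1) L)] [FiberBundle (Cn 1) L]
    [VectorBundle ℂ (Cn 1) L] (k : ℕ) : ℕ → Submodule ℂ (TwistForm n E L k)
  | 0 => ⊥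
  | q + 1 => twistForms n r E L k (q + 1) ⊓ (dbarGraph n r E L k q).map (LinearMap.snd ℂ _ _)

/-- `dim H^q(X, E ⊗ L^k)`, the cohomology being Dolbeault cohomology. -/
def cohomDim (n r : ℕ) {X : Type*} [TopologicalSpace X] [ChartedSpace (Cn n) X]
    (E : X → Type*) [∀ x, AddCommGroup (E x)] [∀ x, Module ℂ (E x)]
    [∀ x, TopologicalSpace (E x)] [TopologicalSpace (TotalSpace (Cn r) E)] [FiberBundle (Cn r) E]
    [VectorBundle ℂ (Cn r) E]
    (L : X → Type*) [∀ x, AddCommGroup (L x)] [∀ x, Module ℂ (L x)]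
    [∀ x, TopologicalSpace (L x)] [TopologicalSpace (TotalSpace (Cn 1) L)] [FiberBundle (Cn 1) L]
    [VectorBundle ℂ (Cn 1) L] (k q : ℕ) : ℕ :=
  Module.finrank ℂ (dbarCycles n r E L k q ⧸
    (dbarBoundaries n r E L k q).submoduleOf (dbarCycles n r E L k q))

/-- The Euler characteristic `χ(X, E ⊗ L^k) = ∑_q (-1)^q dim H^q(X, E ⊗ L^k)`. -/
def eulerChar (n r : ℕ) {X : Type*} [TopologicalSpace X] [ChartedSpace (Cn n) X]
    (E : X → Type*) [∀ x, AddCommGroup (E x)] [∀ x, Module ℂ (E x)]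
    [∀ x, TopologicalSpace (E x)] [TopologicalSpace (TotalSpace (Cn r) E)] [FiberBundle (Cn r) E]
    [VectorBundle ℂ (Cn r) E]
    (L : X → Type*) [∀ x, AddCommGroup (L x)] [∀ x, Module ℂ (L x)]
    [∀ x, TopologicalSpace (L x)] [TopologicalSpace (TotalSpace (Cn 1) L)] [FiberBundle (Cn 1) L]
    [VectorBundle ℂ (Cn 1) L] (k : ℕ) : ℤ :=
  ∑ q ∈ Finset.range (n + 1), (-1) ^ q * (cohomDim n r E L k q : ℤ)

end Dolbeault

/-! ### The moment map and the flow -/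

/-- A scalar form as a multiple of the identity endomorphism. -/
def scalarForm (r : ℕ) (a : Form (Cn n)) : Matrix (Fin r) (Fin r) (Form (Cn n)) :=
  Matrix.diagonal fun _ ↦ a

/-- The exponential of an endomorphism valued `2`-form (powers with `m > n` vanish). -/
def expForm (A : Matrix (Fin r) (Fin r) (Form (Cn n))) : Matrix (Fin r) (Fin r) (Form (Cn n)) :=
  ∑ m ∈ Finset.range (n + 1), ((m.factorial : ℂ)⁻¹) • A ^ m

/-- `(i/2π) F` for the metric with local matrix `H`. -/
def chernForm (H : Cn n → Matrix (Fin r) (Fin r) ℂ) (z : Cn n) :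
    Matrix (Fin r) (Fin r) (Form (Cn n)) :=
  (Complex.I / (2 * (Real.pi : ℂ))) • curvature H z

/-- The moment map `[exp ((i/2π) F + k ω I) Td]^{(2n)}`, in a chart and a holomorphic frame;
`H`, `κ` and `Td` are the local expressions of the metric, the Kähler form and the Todd form. -/
def momentMap (k : ℕ) (κ Td : Cn n → Form (Cn n)) (H : Cn n → Matrix (Fin r) (Fin r) ℂ)
    (z : Cn n) : Matrix (Fin r) (Fin r) (Form (Cn n)) :=
  (expForm (chernForm H z + (k : ℂ) • scalarForm r (κ z)) * scalarForm r (Td z)).map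
    (degreePart (2 * n))

/-- The endomorphism `(n!/ωⁿ) μ`, where `vol = ωⁿ / n!`. -/
def momentDensity (k : ℕ) (κ vol Td : Cn n → Form (Cn n)) (H : Cn n → Matrix (Fin r) (Fin r) ℂ)
    (z : Cn n) : Matrix (Fin r) (Fin r) ℂ :=
  (momentMap k κ Td H z).map fun a ↦ topQuot a (vol z)

/-- The symmetrized product: the average of the products over all orders of the factors. -/
def symProd {A : Type*} [Ring A] [Algebra ℂ A] {N : ℕ} (M : Fin N → A) : A :=
  ((N.factorial : ℂ)⁻¹) • ∑ σ : Equiv.Perm (Fin N), (List.ofFn fun i ↦ M (σ i)).prod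

/-- The right-hand side of the evolution equation of the moment map:
`-∑_{m=1}^n ∑_{l=0}^{m-1} (1/(m-1)!) (i/2π) C(m-1,l) k^l
  ω^l [((i/2π)F)^{m-1-l} ∂̄∂_H ((n!/ωⁿ) μ)]_sym Td_{n-m}`. -/
def evolutionRHS (k : ℕ) (κ vol Td : Cn n → Form (Cn n)) (H : Cn n → Matrix (Fin r) (Fin r) ℂ)
    (z : Cn n) : Matrix (Fin r) (Fin r) (Form (Cn n)) :=
  -∑ m ∈ Finset.Icc 1 n, ∑ l ∈ Finset.range m,
    ((((m - 1).factorial : ℂ)⁻¹) * (Complex.I / (2 * (Real.pi : ℂ))) * ((m - 1).choose l : ℂ) *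
        (k : ℂ) ^ l) •
      (scalarForm r (κ z ^ l) *
        symProd (Fin.snoc (α := fun _ ↦ Matrix (Fin r) (Fin r) (Form (Cn n)))
          (fun _ : Fin (m - 1 - l) ↦ chernForm H z)
          (dbarDH H (momentDensity k κ vol Td H) z)) *
        scalarForm r (degreePart (2 * (n - m)) (Td z)))

section Flow

variable [IsManifold 𝓘(ℂ, Cn n) 1 X] {E : X → Type*} [∀ x, AddCommGroup (E x)] [∀ x, Module ℂ (E x)]
  [∀ x, TopologicalSpace (E x)] [TopologicalSpace (TotalSpace (Cn r) E)] [FiberBundle (Cn r) E]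
  [VectorBundle ℂ (Cn r) E]
  (L : X → Type*) [∀ x, AddCommGroup (L x)] [∀ x, Module ℂ (L x)]
  [∀ x, TopologicalSpace (L x)] [TopologicalSpace (TotalSpace (Cn 1) L)] [FiberBundle (Cn 1) L]
  [VectorBundle ℂ (Cn 1) L]

/-- A path `H(t)`, `0 ≤ t < T`, of Hermitian metrics on `E` that is smooth in space and time. -/
def SmoothPath (T : ℝ) (H : ℝ → HermitianMetric n r E) : Prop :=
  ∀ c ∈ atlas (Cn n) X, ∀ (τ : Trivialization (Cn r) (π (Cn r) E)) [MemTrivializationAtlas τ],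
    ∀ α β, ContDiffOn ℝ ∞ (fun p : ℝ × Cn n ↦ gram (H p.1).inner c τ p.2 α β)
      (Set.Ico 0 T ×ˢ dom c τ)

/-- A smooth solution on `[0, T)` of the almost Hermitian-Einstein flow
`ḣ h⁻¹ = -(n!/ωⁿ) [exp ((i/2π) F + k ω I) Td]^{(2n)} + χ(X, E ⊗ L^k)/rk(E) I`, `h(0) = I`,
where `h(t) = H(t) H₀⁻¹`. -/
structure IsAHEFlow (k : ℕ) (g : HermitianMetric n n (Tan n X)) (Td : FormField n X)
    (T : ℝ) (H₀ : HermitianMetric n r E) (H : ℝ → HermitianMetric n r E) : Prop where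
  smooth : SmoothPath T H
  initial : H 0 = H₀
  flow : ∀ c ∈ atlas (Cn n) X, ∀ (τ : Trivialization (Cn r) (π (Cn r) E))
    [MemTrivializationAtlas τ], ∀ z ∈ dom c τ, ∀ t ∈ Set.Ico 0 T,
      ∃ h' : Matrix (Fin r) (Fin r) ℂ,
        (∀ α β, HasDerivWithinAt
          (fun s ↦ (gram (H s).inner c τ z * (gram H₀.inner c τ z)⁻¹) α β) (h' α β)
            (Set.Ico 0 T) t) ∧
        h' * (gram (H t).inner c τ z * (gram H₀.inner c τ z)⁻¹)⁻¹ =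
          -momentDensity k (kahlerForm g c) (volForm g c) (inChart c Td)
              (gram (H t).inner c τ) z +
            ((eulerChar n r E L k : ℂ) / (r : ℂ)) • (1 : Matrix (Fin r) (Fin r) ℂ)

end Flow

end Manifold

end AHE

end

/-! In a local holomorphic frame put `B = Ḣ H⁻¹`; the flow says that `B` is `-(n!/ωⁿ) μ` plus a
constant multiple of `I`. Differentiating `A = ∂H H⁻¹` in time gives `Ȧ = ∂_H B`, and applying `∂̄`
gives `Ḟ = ∂̄∂_H B` (`hasDerivWithinAt_connCoeff`, `hasWeakDerivWithinAt_curvature`). Since `∂_H`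
kills a constant multiple of `I`, whatever the constant, `Ḟ = -∂̄∂_H((n!/ωⁿ) μ)`
(`dbarDH_neg_add_scalar`).

The rest is algebra with matrices of forms (`hasWeakDerivWithinAt_exp_degreePart`). With `P = (i/2π)
F`, the even form `ω` is central, so `exp(P + kωI)` expands binomially into terms `k^l ω^l P^(m-l)`.
The derivative of `P^N` is `∑ P^i Ṗ P^(N-1-i)`, which is `N` times the symmetrized product
(`symProd_snoc_const`), and `C(m,l) (m-l) / m! = C(m-1,l) / (m-1)!`. Each such term has degree `2m`,
so the part of degree `2n` pairs it with `Td_{n-m}`.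

On the analytic side, the time interval contains its endpoint `0`, so time derivatives are taken
within `[0, T)` and mixed partials are exchanged up to that boundary. -/

namespace AHE

/-! ### Mixed derivatives in time and space on `S × U`, with boundary times allowed. -/

section Calculus

variable {n : ℕ} {S : Set ℝ} {U : Set (Cn n)}

/-- A product of a time domain and an open set of space is a set of unique differentiability. -/
theorem uniqueDiffOn_timeSpace (hS : UniqueDiffOn ℝ S) (hU : IsOpen U) :
    UniqueDiffOn ℝ (S ×ˢ U) :=
  hS.prod hU.uniqueDiffOn

theorem mem_closure_interior_timeSpace (hS : S ⊆ closure (interior S)) (hU : IsOpen U) :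
    S ×ˢ U ⊆ closure (interior (S ×ˢ U)) := by
  rw [interior_prod_eq, hU.interior_eq, closure_prod_eq]
  exact Set.prod_mono hS subset_closure

/-- Slice derivatives become directional derivatives on the product, where joint smoothness and the
symmetry of second derivatives are available. No `within` remains on the left because `U` is open.
-/
theorem fderiv_space_eq {f : ℝ × Cn n → ℂ} (hU : IsOpen U)
    {t : ℝ} {z : Cn n} (ht : t ∈ S) (hz : z ∈ U)
    (hf : DifferentiableWithinAt ℝ f (S ×ˢ U) (t, z)) (v : Cn n) :
    fderiv ℝ (fun w ↦ f (t, w)) z v = fderivWithin ℝ f (S ×ˢ U) (t, z) (0, v) := by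
  have h := hf.hasFDerivWithinAt.comp z (s := U) (hasFDerivAt_prodMk_right t z).hasFDerivWithinAt
    (fun w hw ↦ ⟨ht, hw⟩)
  have h' := (h.hasFDerivAt (hU.mem_nhds hz)).fderiv
  have h2 := congrArg (fun L ↦ L v) h'
  simpa [Function.comp_def] using h2

theorem hasDerivWithinAt_time {f : ℝ × Cn n → ℂ} {t : ℝ} {z : Cn n} (hz : z ∈ U)
    (hf : DifferentiableWithinAt ℝ f (S ×ˢ U) (t, z)) :
    HasDerivWithinAt (fun s ↦ f (s, z)) (fderivWithin ℝ f (S ×ˢ U) (t, z) (1, 0)) S t := by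
  have h := HasFDerivWithinAt.comp (f := fun s ↦ (s, z)) (s := S) t hf.hasFDerivWithinAt
    (hasFDerivAt_prodMk_left t z).hasFDerivWithinAt (fun w hw ↦ ⟨hw, hz⟩)
  have := h.hasDerivWithinAt
  simpa [Function.comp_def] using this

theorem contDiffOn_fderivWithin_apply {f : ℝ × Cn n → ℂ} (hS : UniqueDiffOn ℝ S) (hU : IsOpen U)
    (hf : ContDiffOn ℝ ∞ f (S ×ˢ U)) (v : ℝ × Cn n) :
    ContDiffOn ℝ ∞ (fun p ↦ fderivWithin ℝ f (S ×ˢ U) p v) (S ×ˢ U) :=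
  (hf.fderivWithin (uniqueDiffOn_timeSpace hS hU) (by simp)).clm_apply contDiffOn_const

theorem contDiffOn_fderiv_space {f : ℝ × Cn n → ℂ} (hS : UniqueDiffOn ℝ S) (hU : IsOpen U)
    (hf : ContDiffOn ℝ ∞ f (S ×ˢ U)) (v : Cn n) :
    ContDiffOn ℝ ∞ (fun p : ℝ × Cn n ↦ fderiv ℝ (fun w ↦ f (p.1, w)) p.2 v) (S ×ˢ U) :=
  (contDiffOn_fderivWithin_apply hS hU hf (0, v)).congr fun p hp ↦
    fderiv_space_eq hU hp.1 hp.2 (hf.differentiableOn (by simp) p hp) v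

/-- Derivatives in space and time commute. -/
theorem hasDerivWithinAt_fderiv_space {f f' : ℝ × Cn n → ℂ} (hS : UniqueDiffOn ℝ S)
    (hS' : S ⊆ closure (interior S)) (hU : IsOpen U) (hf : ContDiffOn ℝ ∞ f (S ×ˢ U))
    (hf' : ∀ t ∈ S, ∀ z ∈ U, HasDerivWithinAt (fun s ↦ f (s, z)) (f' (t, z)) S t)
    {t : ℝ} {z : Cn n} (ht : t ∈ S) (hz : z ∈ U) (v : Cn n) :
    HasDerivWithinAt (fun s ↦ fderiv ℝ (fun w ↦ f (s, w)) z v)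
      (fderiv ℝ (fun w ↦ f' (t, w)) z v) S t := by
  have hp : (t, z) ∈ S ×ˢ U := ⟨ht, hz⟩
  have hΩ := uniqueDiffOn_timeSpace hS hU
  have hd : DifferentiableWithinAt ℝ (fderivWithin ℝ f (S ×ˢ U)) (S ×ˢ U) (t, z) :=
    (hf.fderivWithin hΩ (m := ∞) (by simp)).differentiableOn (by simp) _ hp
  have hda : ∀ u : ℝ × Cn n, HasFDerivWithinAt (fun p ↦ fderivWithin ℝ f (S ×ˢ U) p u)
      ((fderivWithin ℝ (fderivWithin ℝ f (S ×ˢ U)) (S ×ˢ U) (t, z)).flip u) (S ×ˢ U) (t, z) := by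
    intro u
    have := hd.hasFDerivWithinAt.clm_apply (hasFDerivWithinAt_const u (t, z) (S ×ˢ U))
    simpa using this
  -- Symmetry extends to boundary times because `(t, z)` is a limit of interior points of `S × U`.
  have hsymm : IsSymmSndFDerivWithinAt ℝ f (S ×ˢ U) (t, z) :=
    (hf _ hp).isSymmSndFDerivWithinAt (by
      rw [minSmoothness_of_isRCLikeNormedField]
      exact WithTop.coe_le_coe.2 (le_top (a := (2 : ℕ∞)))) hΩ
      (mem_closure_interior_timeSpace hS' hU hp) hp
  have h1 := hasDerivWithinAt_time hz (hda (0, v)).differentiableWithinAt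
  rw [(hda (0, v)).fderivWithin (hΩ _ hp)] at h1
  have h2 : fderiv ℝ (fun w ↦ f' (t, w)) z v =
      fderivWithin ℝ (fderivWithin ℝ f (S ×ˢ U)) (S ×ˢ U) (t, z) (1, 0) (0, v) := by
    -- No regularity of `f'` is given; uniqueness of the time derivative identifies it near `z` with
    -- a derivative of the smooth `f`.
    have : (fun w ↦ f' (t, w)) =ᶠ[nhds z] fun w ↦ fderivWithin ℝ f (S ×ˢ U) (t, w) (1, 0) := by
      filter_upwards [hU.mem_nhds hz] with w hw
      exact (hS t ht).eq_deriv _ (hf' t ht w hw)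
        (hasDerivWithinAt_time hw (hf.differentiableOn (by simp) _ ⟨ht, hw⟩))
    rw [this.fderiv_eq, fderiv_space_eq (f := fun p ↦ fderivWithin ℝ f (S ×ˢ U) p (1, 0))
      hU ht hz (hda (1, 0)).differentiableWithinAt, (hda (1, 0)).fderivWithin (hΩ _ hp)]
    simpa using hsymm (0, v) (1, 0)
  rw [h2]
  refine (h1.congr_of_mem (fun s hs ↦ ?_) ht)
  exact fderiv_space_eq hU hs hz (hf.differentiableOn (by simp) _ ⟨hs, hz⟩) v

theorem contDiffOn_wirt {f : ℝ × Cn n → ℂ} (hS : UniqueDiffOn ℝ S) (hU : IsOpen U)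
    (hf : ContDiffOn ℝ ∞ f (S ×ˢ U)) (j : Fin n) :
    ContDiffOn ℝ ∞ (fun p : ℝ × Cn n ↦ wirt j (fun w ↦ f (p.1, w)) p.2) (S ×ˢ U) :=
  contDiffOn_const.mul ((contDiffOn_fderiv_space hS hU hf _).sub
    (contDiffOn_const.mul (contDiffOn_fderiv_space hS hU hf _)))

theorem hasDerivWithinAt_wirt {f f' : ℝ × Cn n → ℂ} (hS : UniqueDiffOn ℝ S)
    (hS' : S ⊆ closure (interior S)) (hU : IsOpen U) (hf : ContDiffOn ℝ ∞ f (S ×ˢ U))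
    (hf' : ∀ t ∈ S, ∀ z ∈ U, HasDerivWithinAt (fun s ↦ f (s, z)) (f' (t, z)) S t)
    {t : ℝ} {z : Cn n} (ht : t ∈ S) (hz : z ∈ U) (j : Fin n) :
    HasDerivWithinAt (fun s ↦ wirt j (fun w ↦ f (s, w)) z) (wirt j (fun w ↦ f' (t, w)) z) S t :=
  ((hasDerivWithinAt_fderiv_space hS hS' hU hf hf' ht hz _).sub
    ((hasDerivWithinAt_fderiv_space hS hS' hU hf hf' ht hz _).const_mul _)).const_mul _

theorem hasDerivWithinAt_wirtBar {f f' : ℝ × Cn n → ℂ} (hS : UniqueDiffOn ℝ S)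
    (hS' : S ⊆ closure (interior S)) (hU : IsOpen U) (hf : ContDiffOn ℝ ∞ f (S ×ˢ U))
    (hf' : ∀ t ∈ S, ∀ z ∈ U, HasDerivWithinAt (fun s ↦ f (s, z)) (f' (t, z)) S t)
    {t : ℝ} {z : Cn n} (ht : t ∈ S) (hz : z ∈ U) (j : Fin n) :
    HasDerivWithinAt (fun s ↦ wirtBar j (fun w ↦ f (s, w)) z)
      (wirtBar j (fun w ↦ f' (t, w)) z) S t :=
  ((hasDerivWithinAt_fderiv_space hS hS' hU hf hf' ht hz _).add
    ((hasDerivWithinAt_fderiv_space hS hS' hU hf hf' ht hz _).const_mul _)).const_mul _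

theorem wirt_neg (f : Cn n → ℂ) (j : Fin n) (z : Cn n) :
    wirt j (fun w ↦ -f w) z = -wirt j f z := by
  simp only [wirt, fderiv_fun_neg, neg_apply]
  ring

theorem wirtBar_neg (f : Cn n → ℂ) (j : Fin n) (z : Cn n) :
    wirtBar j (fun w ↦ -f w) z = -wirtBar j f z := by
  simp only [wirtBar, fderiv_fun_neg, neg_apply]
  ring

theorem wirt_add_const (f : Cn n → ℂ) (a : ℂ) (j : Fin n) (z : Cn n) :
    wirt j (fun w ↦ f w + a) z = wirt j f z := by
  simp only [wirt, fderiv_add_const]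

theorem wirt_sum_mul {ι : Type*} [Fintype ι] {f g : ι → Cn n → ℂ} {z : Cn n}
    (hf : ∀ i, DifferentiableAt ℝ (f i) z) (hg : ∀ i, DifferentiableAt ℝ (g i) z) (j : Fin n) :
    wirt j (fun w ↦ ∑ i, f i w * g i w) z =
      ∑ i, (wirt j (f i) z * g i z + f i z * wirt j (g i) z) := by
  have h : fderiv ℝ (fun w ↦ ∑ i, f i w * g i w) z =
      ∑ i, (f i z • fderiv ℝ (g i) z + g i z • fderiv ℝ (f i) z) := by
    rw [fderiv_fun_sum fun i _ ↦ (hf i).fun_mul (hg i)]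
    exact Finset.sum_congr rfl fun i _ ↦ fderiv_fun_mul (hf i) (hg i)
  simp only [wirt, h, sum_apply, Finset.mul_sum, ← Finset.sum_sub_distrib]
  refine Finset.sum_congr rfl fun i _ ↦ ?_
  simp only [add_apply, smul_apply, smul_eq_mul]
  ring

end Calculus

/-! ### Curves in finite-dimensional algebras, differentiated without choosing a norm. -/

section WeakDerivative

/-- The derivative within `S` of a curve in a complex vector space, tested on linear functionals. -/
def HasWeakDerivWithinAt {V : Type*} [AddCommGroup V] [Module ℂ V] (f : ℝ → V) (f' : V)
    (S : Set ℝ) (t : ℝ) : Prop :=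
  ∀ l : V →ₗ[ℂ] ℂ, HasDerivWithinAt (fun s ↦ l (f s)) (l f') S t

variable {V W : Type*} [AddCommGroup V] [Module ℂ V] [AddCommGroup W] [Module ℂ W]
  {S : Set ℝ} {t : ℝ}

namespace HasWeakDerivWithinAt

theorem const (v : V) : HasWeakDerivWithinAt (fun _ ↦ v) 0 S t := fun l ↦ by
  rw [map_zero]
  exact hasDerivWithinAt_const t S (l v)

theorem map {f : ℝ → V} {f' : V} (hf : HasWeakDerivWithinAt f f' S t) (L : V →ₗ[ℂ] W) :
    HasWeakDerivWithinAt (fun s ↦ L (f s)) (L f') S t :=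
  fun l ↦ hf (l ∘ₗ L)

theorem sum {ι : Type*} {u : Finset ι} {f : ι → ℝ → V} {f' : ι → V}
    (hf : ∀ i ∈ u, HasWeakDerivWithinAt (f i) (f' i) S t) :
    HasWeakDerivWithinAt (fun s ↦ ∑ i ∈ u, f i s) (∑ i ∈ u, f' i) S t := fun l ↦ by
  simp only [map_sum]
  exact HasDerivWithinAt.fun_sum fun i hi ↦ hf i hi l

theorem smul_const {a : ℝ → ℂ} {a' : ℂ} (ha : HasDerivWithinAt a a' S t) (v : V) :
    HasWeakDerivWithinAt (fun s ↦ a s • v) (a' • v) S t := fun l ↦ by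
  have h : ∀ c : ℂ, l (c • v) = c * l v := fun c ↦ l.map_smul c v
  simp only [h]
  exact ha.mul_const (l v)

theorem const_smul {f : ℝ → V} {f' : V} (hf : HasWeakDerivWithinAt f f' S t) (a : ℂ) :
    HasWeakDerivWithinAt (fun s ↦ a • f s) (a • f') S t :=
  hf.map (a • LinearMap.id)

variable {A : Type*} [Ring A] [Algebra ℂ A]

/-- In a finite basis, `l (x * y)` is a bilinear polynomial in the coordinates of `x` and `y`, so
the scalar product rule suffices. -/
theorem mul [Module.Finite ℂ A] {f g : ℝ → A} {f' g' : A}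
    (hf : HasWeakDerivWithinAt f f' S t) (hg : HasWeakDerivWithinAt g g' S t) :
    HasWeakDerivWithinAt (fun s ↦ f s * g s) (f' * g t + f t * g') S t := by
  intro l
  let b := Module.finBasis ℂ A
  have key : ∀ x y : A, l (x * y) = ∑ i, ∑ j, b.coord i x * b.coord j y * l (b i * b j) := by
    intro x y
    conv_lhs => rw [← b.sum_repr x, ← b.sum_repr y]
    simp only [Finset.sum_mul_sum, map_sum, smul_mul_smul_comm, map_smul, smul_eq_mul,
      Module.Basis.coord_apply]
  have hfun : (fun s ↦ l (f s * g s)) =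
      fun s ↦ ∑ i, ∑ j, b.coord i (f s) * b.coord j (g s) * l (b i * b j) :=
    funext fun s ↦ key _ _
  change HasDerivWithinAt (fun s ↦ l (f s * g s)) _ _ _
  rw [hfun]
  refine (HasDerivWithinAt.fun_sum fun i (_ : i ∈ Finset.univ) ↦
    HasDerivWithinAt.fun_sum fun j (_ : j ∈ Finset.univ) ↦
      ((hf (b.coord i)).fun_mul (hg (b.coord j))).mul_const (l (b i * b j))).congr_deriv ?_
  rw [map_add, key, key, ← Finset.sum_add_distrib]
  refine Finset.sum_congr rfl fun i _ ↦ ?_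
  rw [← Finset.sum_add_distrib]
  exact Finset.sum_congr rfl fun j _ ↦ add_mul _ _ _

/-- Since `f'` need not commute with `f t`, it appears once in each of the `N` slots; this sum over
slots is what symmetrization produces. -/
theorem pow [Module.Finite ℂ A] {f : ℝ → A} {f' : A} (hf : HasWeakDerivWithinAt f f' S t) (N : ℕ) :
    HasWeakDerivWithinAt (fun s ↦ f s ^ N)
      (∑ i ∈ Finset.range N, f t ^ i * f' * f t ^ (N - 1 - i)) S t := by
  induction N with
  | zero => simpa using const (1 : A)
  | succ N ih =>
    simp only [pow_succ]
    convert ih.mul hf using 1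
    rw [Finset.sum_range_succ, Finset.sum_mul]
    congr 1
    · refine Finset.sum_congr rfl fun i hi ↦ ?_
      rw [Finset.mem_range] at hi
      rw [mul_assoc _ _ (f t), ← pow_succ, show N + 1 - 1 - i = N - 1 - i + 1 by omega]
    · simp

end HasWeakDerivWithinAt

end WeakDerivative

/-! ### Averages over orderings with one distinguished factor. -/

section Symmetrization

/-- The sum does not depend on `x`, since right translation by a transposition moves `x` to any
other point. Summing it over all points therefore multiplies it by the cardinality, and each
permutation then contributes the full sum of `f`. -/
theorem sum_perm_apply {ι M : Type*} [Fintype ι] [DecidableEq ι] [AddCommGroup M] [Module ℂ M]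
    (f : ι → M) (x : ι) :
    ∑ σ : Equiv.Perm ι, f (σ x) =
      (((Fintype.card ι).factorial : ℂ) / (Fintype.card ι : ℂ)) • ∑ i, f i := by
  have h : ∀ y, ∑ σ : Equiv.Perm ι, f (σ y) = ∑ σ : Equiv.Perm ι, f (σ x) := fun y ↦
    Fintype.sum_equiv (Equiv.mulRight (Equiv.swap x y)) _ _ fun σ ↦ by simp
  have h2 : (Fintype.card ι : ℂ) • ∑ σ : Equiv.Perm ι, f (σ x) =
      ((Fintype.card ι).factorial : ℂ) • ∑ i, f i := by
    calc _ = ∑ y, ∑ σ : Equiv.Perm ι, f (σ y) := by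
          simp [h, Nat.cast_smul_eq_nsmul]
      _ = ∑ σ : Equiv.Perm ι, ∑ y, f (σ y) := Finset.sum_comm
      _ = ∑ _σ : Equiv.Perm ι, ∑ i, f i :=
          Finset.sum_congr rfl fun σ _ ↦ Equiv.sum_comp σ f
      _ = _ := by simp [Fintype.card_perm, Nat.cast_smul_eq_nsmul]
  have hc : (Fintype.card ι : ℂ) ≠ 0 := by
    have : Nonempty ι := ⟨x⟩
    exact_mod_cast Fintype.card_ne_zero
  rw [div_eq_inv_mul, mul_smul, ← h2, smul_smul, inv_mul_cancel₀ hc, one_smul]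

theorem prod_ofFn_single {A : Type*} [Monoid A] (P D : A) {N : ℕ} (i : Fin N) :
    (List.ofFn fun j : Fin N ↦ if j = i then D else P).prod =
      P ^ (i : ℕ) * D * P ^ (N - 1 - i) := by
  induction N with
  | zero => exact i.elim0
  | succ N ih =>
    rw [List.ofFn_succ, List.prod_cons]
    refine Fin.cases ?_ (fun i ↦ ?_) i
    · simp [Fin.succ_ne_zero]
    · simp only [Fin.succ_inj, ih, (Fin.succ_ne_zero i).symm, if_false, Fin.val_succ, pow_succ',
        mul_assoc]
      congr 4
      omega

/-- The symmetrized product of `N` factors `P` and one factor `D`. -/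
theorem symProd_snoc_const {A : Type*} [Ring A] [Algebra ℂ A] (P D : A) (N : ℕ) :
    symProd (Fin.snoc (α := fun _ ↦ A) (fun _ : Fin N ↦ P) D) =
      ((N + 1 : ℕ) : ℂ)⁻¹ • ∑ i ∈ Finset.range (N + 1), P ^ i * D * P ^ (N - i) := by
  -- An ordering matters only through the slot `σ⁻¹ (Fin.last N)` in which `D` lands.
  have h : ∀ σ : Equiv.Perm (Fin (N + 1)),
      (List.ofFn fun i ↦ Fin.snoc (α := fun _ ↦ A) (fun _ : Fin N ↦ P) D (σ i)).prod =
        P ^ (σ⁻¹ (Fin.last N) : ℕ) * D * P ^ (N - (σ⁻¹ (Fin.last N) : ℕ)) := by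
    intro σ
    have := prod_ofFn_single P D (σ⁻¹ (Fin.last N))
    rw [Nat.add_sub_cancel] at this
    rw [← this]
    congr 2
    ext j
    by_cases hj : σ j = Fin.last N
    · rw [if_pos (Equiv.Perm.eq_inv_iff_eq.2 hj), hj, Fin.snoc_last]
    · obtain ⟨i, hi⟩ := Fin.exists_castSucc_eq.2 hj
      rw [if_neg fun h ↦ hj (Equiv.Perm.eq_inv_iff_eq.1 h), ← hi, Fin.snoc_castSucc]
  unfold symProd
  simp only [h]
  -- Reindexing by inversion replaces `σ⁻¹` by `σ`.
  rw [Fintype.sum_equiv (Equiv.inv (Equiv.Perm (Fin (N + 1))))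
    (fun σ ↦ P ^ (σ⁻¹ (Fin.last N) : ℕ) * D * P ^ (N - (σ⁻¹ (Fin.last N) : ℕ)))
    (fun σ ↦ P ^ (σ (Fin.last N) : ℕ) * D * P ^ (N - (σ (Fin.last N) : ℕ))) (fun σ ↦ rfl),
    sum_perm_apply (fun i : Fin (N + 1) ↦ P ^ (i : ℕ) * D * P ^ (N - (i : ℕ))), smul_smul,
    Fin.sum_univ_eq_sum_range (fun i ↦ P ^ i * D * P ^ (N - i)), Fintype.card_fin]
  congr 1
  have := Nat.factorial_ne_zero (N + 1)
  field_simp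

end Symmetrization

/-! ### Grading and central elements in matrices of forms; the derivative of the exponential. -/

section Forms

variable {n r : ℕ}

instance : Module.Finite ℂ (Form (Cn n)) := Module.Finite.of_basis (formBasis n)

/-- Moving a covector past two others changes the sign twice. This makes the Kähler form central. -/
theorem ι_mul_ι_mul_comm {V : Type*} [AddCommGroup V] [Module ℂ V] (x y : V)
    (a : ExteriorAlgebra ℂ V) :
    Commute (ExteriorAlgebra.ι ℂ x * ExteriorAlgebra.ι ℂ y) a := by
  induction a using ExteriorAlgebra.induction with
  | algebraMap c => exact (Algebra.commutes c _).symm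
  | ι v =>
    have h : ∀ a b : V, ExteriorAlgebra.ι ℂ a * ExteriorAlgebra.ι ℂ b =
        -(ExteriorAlgebra.ι ℂ b * ExteriorAlgebra.ι ℂ a) := fun a b ↦
      eq_neg_of_add_eq_zero_left (ExteriorAlgebra.ι_add_mul_swap a b)
    rw [Commute, SemiconjBy, mul_assoc, h y v, mul_neg, ← mul_assoc, h x v, neg_mul, neg_neg,
      mul_assoc]
  | mul a b ha hb => exact ha.mul_right hb
  | add a b ha hb => exact ha.add_right hb

/-- A matrix of forms all of whose entries are homogeneous of degree `p`. -/
def IsHomogeneousMatrix (p : ℕ) (M : Matrix (Fin r) (Fin r) (Form (Cn n))) : Prop :=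
  ∀ α β, M α β ∈ ⋀[ℂ]^p (Cotangent (Cn n))

theorem IsHomogeneousMatrix.mul {p q : ℕ} {M N : Matrix (Fin r) (Fin r) (Form (Cn n))}
    (hM : IsHomogeneousMatrix p M) (hN : IsHomogeneousMatrix q N) :
    IsHomogeneousMatrix (p + q) (M * N) := fun α β ↦ by
  rw [Matrix.mul_apply]
  exact Submodule.sum_mem _ fun γ _ ↦
    SetLike.mul_mem_graded (A := fun i : ℕ ↦ ⋀[ℂ]^i (Cotangent (Cn n))) (hM α γ) (hN γ β)

theorem IsHomogeneousMatrix.smul {p : ℕ} {M : Matrix (Fin r) (Fin r) (Form (Cn n))}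
    (hM : IsHomogeneousMatrix p M) (a : ℂ) : IsHomogeneousMatrix p (a • M) :=
  fun α β ↦ Submodule.smul_mem _ a (hM α β)

theorem IsHomogeneousMatrix.sum {ι : Type*} {u : Finset ι} {p : ℕ}
    {M : ι → Matrix (Fin r) (Fin r) (Form (Cn n))}
    (hM : ∀ i ∈ u, IsHomogeneousMatrix p (M i)) : IsHomogeneousMatrix p (∑ i ∈ u, M i) :=
  fun α β ↦ by
    rw [Matrix.sum_apply]
    exact Submodule.sum_mem _ fun i hi ↦ hM i hi α β

theorem isHomogeneousMatrix_scalarForm {p : ℕ} {a : Form (Cn n)}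
    (ha : a ∈ ⋀[ℂ]^p (Cotangent (Cn n))) : IsHomogeneousMatrix p (scalarForm r a) := fun α β ↦ by
  rw [scalarForm, Matrix.diagonal_apply]
  split_ifs
  · exact ha
  · exact zero_mem _

theorem IsHomogeneousMatrix.pow {p : ℕ} {M : Matrix (Fin r) (Fin r) (Form (Cn n))}
    (hM : IsHomogeneousMatrix p M) (N : ℕ) : IsHomogeneousMatrix (N * p) (M ^ N) := by
  induction N with
  | zero =>
    rw [pow_zero, zero_mul, ← Matrix.diagonal_one]
    exact isHomogeneousMatrix_scalarForm
      (SetLike.one_mem_graded (fun i : ℕ ↦ ⋀[ℂ]^i (Cotangent (Cn n))))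
  | succ N ih =>
    rw [pow_succ, Nat.succ_mul]
    exact ih.mul hM

theorem dzbar_mul_dz_mem (k j : Fin n) : dzbar k * dz j ∈ ⋀[ℂ]^2 (Cotangent (Cn n)) := by
  rw [ExteriorAlgebra.exteriorPower, pow_two]
  exact Submodule.mul_mem_mul (LinearMap.mem_range_self _ _) (LinearMap.mem_range_self _ _)

theorem dz_mul_dzbar_mem (j k : Fin n) : dz j * dzbar k ∈ ⋀[ℂ]^2 (Cotangent (Cn n)) := by
  rw [ExteriorAlgebra.exteriorPower, pow_two]
  exact Submodule.mul_mem_mul (LinearMap.mem_range_self _ _) (LinearMap.mem_range_self _ _)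

theorem degreePart_mul_of_mem {p q : ℕ} {a : Form (Cn n)} (ha : a ∈ ⋀[ℂ]^p (Cotangent (Cn n)))
    (b : Form (Cn n)) : degreePart (p + q) (a * b) = a * degreePart q b := by
  have := DirectSum.coe_decompose_mul_of_left_mem_of_le
    (fun i : ℕ ↦ ⋀[ℂ]^i (Cotangent (Cn n))) (b := b) ha (Nat.le_add_right p q)
  rw [Nat.add_sub_cancel_left] at this
  exact this

/-- With `p = 2m` and `p + q = 2n`, this is how the component `Td_{n-m}` arises. -/
theorem mul_scalarForm_map_degreePart {p q : ℕ} {M : Matrix (Fin r) (Fin r) (Form (Cn n))}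
    (hM : IsHomogeneousMatrix p M) (a : Form (Cn n)) :
    (M * scalarForm r a).map (degreePart (p + q)) = M * scalarForm r (degreePart q a) := by
  ext α β
  simp only [scalarForm, Matrix.map_apply, Matrix.mul_diagonal]
  exact degreePart_mul_of_mem (hM α β) a

theorem scalarForm_pow (a : Form (Cn n)) (l : ℕ) : scalarForm r a ^ l = scalarForm r (a ^ l) :=
  Matrix.diagonal_pow _ _

theorem isHomogeneousMatrix_curvature (H : Cn n → Matrix (Fin r) (Fin r) ℂ) (z : Cn n) :
    IsHomogeneousMatrix 2 (curvature H z) := fun α β ↦ by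
  rw [curvature, Matrix.of_apply]
  exact Submodule.sum_mem _ fun j _ ↦ Submodule.sum_mem _ fun k _ ↦
    Submodule.smul_mem _ _ (dzbar_mul_dz_mem k j)

theorem isHomogeneousMatrix_dbarDH (H Φ : Cn n → Matrix (Fin r) (Fin r) ℂ) (z : Cn n) :
    IsHomogeneousMatrix 2 (dbarDH H Φ z) := fun α β ↦ by
  rw [dbarDH, Matrix.of_apply]
  exact Submodule.sum_mem _ fun j _ ↦ Submodule.sum_mem _ fun k _ ↦
    Submodule.smul_mem _ _ (dzbar_mul_dz_mem k j)

theorem commute_scalarForm {a : Form (Cn n)} (ha : ∀ b, Commute a b)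
    (M : Matrix (Fin r) (Fin r) (Form (Cn n))) : Commute (scalarForm r a) M := by
  ext α β
  simp only [scalarForm, Matrix.mul_diagonal, Matrix.diagonal_mul]
  exact ha _

/-- The derivative of the form `[exp (P + k a I) Td]^{(2n)}` along a curve of matrices `P` of
`2`-forms, for a central `2`-form `a`. -/
theorem hasWeakDerivWithinAt_exp_degreePart {S : Set ℝ} {t : ℝ}
    {P : ℝ → Matrix (Fin r) (Fin r) (Form (Cn n))} {D : Matrix (Fin r) (Fin r) (Form (Cn n))}
    (hP : IsHomogeneousMatrix 2 (P t)) (hD : IsHomogeneousMatrix 2 D)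
    (hPD : HasWeakDerivWithinAt P D S t) {a : Form (Cn n)}
    (ha : a ∈ ⋀[ℂ]^2 (Cotangent (Cn n))) (ha' : ∀ b, Commute a b) (k : ℕ) (Td : Form (Cn n)) :
    HasWeakDerivWithinAt
      (fun s ↦ (expForm (P s + (k : ℂ) • scalarForm r a) * scalarForm r Td).map
        (degreePart (2 * n)))
      (∑ m ∈ Finset.Icc 1 n, ∑ l ∈ Finset.range m,
        ((((m - 1).factorial : ℂ)⁻¹) * ((m - 1).choose l : ℂ) * (k : ℂ) ^ l) •
          (scalarForm r (a ^ l) *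
            symProd (Fin.snoc (α := fun _ ↦ Matrix (Fin r) (Fin r) (Form (Cn n)))
              (fun _ : Fin (m - 1 - l) ↦ P t) D) *
            scalarForm r (degreePart (2 * (n - m)) Td))) S t := by
  -- The binomial theorem applies because `a I` commutes with `P s`.
  have hexp : ∀ s, expForm (P s + (k : ℂ) • scalarForm r a) =
      ∑ m ∈ Finset.range (n + 1), ∑ l ∈ Finset.range (m + 1),
        (((m.factorial : ℂ)⁻¹) * (m.choose l : ℂ) * (k : ℂ) ^ l) •
          (scalarForm r (a ^ l) * P s ^ (m - l)) := by
    intro s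
    unfold expForm
    refine Finset.sum_congr rfl fun m _ ↦ ?_
    rw [add_comm, ((commute_scalarForm ha' (P s)).smul_left (k : ℂ)).add_pow, Finset.smul_sum]
    refine Finset.sum_congr rfl fun l _ ↦ ?_
    rw [smul_pow, scalarForm_pow, smul_mul_assoc, smul_mul_assoc, ← nsmul_eq_mul',
      ← Nat.cast_smul_eq_nsmul ℂ, smul_smul, smul_smul]
    congr 1
    ring
  have hL : ∀ X : Matrix (Fin r) (Fin r) (Form (Cn n)),
      (X * scalarForm r Td).map (degreePart (2 * n)) =
        ((degreePart (2 * n)).mapMatrix ∘ₗ LinearMap.mulRight ℂ (scalarForm r Td)) X :=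
    fun X ↦ rfl
  have hder := ((HasWeakDerivWithinAt.sum (u := Finset.range (n + 1)) fun m _ ↦
    HasWeakDerivWithinAt.sum (u := Finset.range (m + 1)) fun l _ ↦
      ((hPD.pow (m - l)).map (LinearMap.mulLeft ℂ (scalarForm r (a ^ l)))).const_smul
        (((m.factorial : ℂ)⁻¹) * (m.choose l : ℂ) * (k : ℂ) ^ l)).map
      ((degreePart (2 * n)).mapMatrix ∘ₗ LinearMap.mulRight ℂ (scalarForm r Td)))
  simp only [hexp, hL]
  simp only [LinearMap.mulLeft_apply] at hder
  convert hder using 1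
  -- The `m = 0` term of the exponential is constant in time and drops out.
  rw [Finset.range_eq_Ico, Finset.sum_eq_sum_Ico_succ_bot (Nat.succ_pos n)]
  simp only [zero_add, Finset.range_one, Finset.sum_singleton, Nat.sub_zero, Finset.range_zero,
    Finset.sum_empty, mul_zero, smul_zero]
  rw [map_sum]
  refine Finset.sum_congr (by ext; simp) fun m hm ↦ ?_
  rw [Finset.mem_Ico] at hm
  -- The `l = m` term contains no `P`, so its derivative vanishes and `l` stops at `m - 1`.
  rw [Finset.sum_range_succ, Nat.sub_self]
  rw [Finset.range_zero, Finset.sum_empty, mul_zero, smul_zero, add_zero, map_sum]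
  refine Finset.sum_congr rfl fun l hl ↦ ?_
  rw [Finset.mem_range] at hl
  rw [LinearMap.map_smul]
  -- `N` counts the undifferentiated factors `P`; the substitution removes the truncated
  -- subtractions.
  obtain ⟨N, rfl⟩ : ∃ N, m = N + 1 + l := ⟨m - 1 - l, by omega⟩
  rw [show N + 1 + l - 1 - l = N by omega, show N + 1 + l - l = N + 1 by omega,
    symProd_snoc_const, mul_smul_comm, smul_mul_assoc, smul_smul, Nat.add_sub_cancel N 1,
    LinearMap.comp_apply, LinearMap.mulRight_apply]
  have hom : IsHomogeneousMatrix (2 * (N + 1 + l)) (scalarForm r (a ^ l) *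
      ∑ i ∈ Finset.range (N + 1), P t ^ i * D * P t ^ (N - i)) := by
    rw [show 2 * (N + 1 + l) = l * 2 + (N + 1) * 2 by ring, ← scalarForm_pow]
    refine ((isHomogeneousMatrix_scalarForm ha).pow l).mul (IsHomogeneousMatrix.sum fun i hi ↦ ?_)
    rw [Finset.mem_range] at hi
    rw [show (N + 1) * 2 = i * 2 + 2 + (N - i) * 2 by omega]
    exact ((hP.pow i).mul hD).mul (hP.pow _)
  have hmap := mul_scalarForm_map_degreePart (q := 2 * (n - (N + 1 + l))) hom Td
  -- The bound `m ≤ n` makes `n - m` a genuine difference.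
  rw [show 2 * (N + 1 + l) + 2 * (n - (N + 1 + l)) = 2 * n by omega] at hmap
  rw [LinearMap.mapMatrix_apply, hmap]
  congr 1
  -- The identity `m C(m-1,l) = (m-l) C(m,l)`; the factor `m - l = N + 1` is the normalization of
  -- the symmetrized product.
  have h1 : ((N + l + 1 : ℕ) : ℂ) * ((N + l).choose l : ℂ) =
      ((N + l + 1).choose l : ℂ) * ((N + 1 : ℕ) : ℂ) := by
    have := Nat.choose_mul_succ_eq (N + l) l
    rw [show N + l + 1 - l = N + 1 by omega, mul_comm] at this
    exact_mod_cast this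
  have h2 : ((N + l + 1 : ℕ) : ℂ) ≠ 0 := Nat.cast_ne_zero.2 (Nat.succ_ne_zero _)
  have h3 : ((N + 1 : ℕ) : ℂ) ≠ 0 := Nat.cast_ne_zero.2 (Nat.succ_ne_zero _)
  have h4 : ((N + l).factorial : ℂ) ≠ 0 := Nat.cast_ne_zero.2 (Nat.factorial_ne_zero _)
  rw [show N + 1 + l = N + l + 1 by ring, Nat.add_sub_cancel, Nat.factorial_succ, Nat.cast_mul]
  field_simp
  linear_combination (k : ℂ) ^ l * h1

end Forms

/-! ### Passage between matrix curves and their entries. -/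

namespace HasWeakDerivWithinAt

variable {r : ℕ} {V : Type*} [AddCommGroup V] [Module ℂ V] {S : Set ℝ} {t : ℝ}

theorem of_hasDerivWithinAt {a : ℝ → ℂ} {a' : ℂ} (ha : HasDerivWithinAt a a' S t) :
    HasWeakDerivWithinAt a a' S t := by
  simpa using smul_const ha (1 : ℂ)

theorem matrix {M : ℝ → Matrix (Fin r) (Fin r) V} {M' : Matrix (Fin r) (Fin r) V}
    (h : ∀ α β, HasWeakDerivWithinAt (fun s ↦ M s α β) (M' α β) S t) :
    HasWeakDerivWithinAt M M' S t := by
  have key : ∀ N : Matrix (Fin r) (Fin r) V,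
      N = ∑ α, ∑ β, Matrix.singleLinearMap ℂ α β (N α β) := Matrix.matrix_eq_sum_single
  have := sum (u := Finset.univ) fun α _ ↦ sum (u := Finset.univ) fun β _ ↦
    (h α β).map (Matrix.singleLinearMap ℂ α β)
  simpa only [← key] using this

theorem entry {M : ℝ → Matrix (Fin r) (Fin r) ℂ} {M' : Matrix (Fin r) (Fin r) ℂ}
    (h : HasWeakDerivWithinAt M M' S t) (α β : Fin r) :
    HasDerivWithinAt (fun s ↦ M s α β) (M' α β) S t :=
  h (Matrix.entryLinearMap ℂ ℂ α β)

end HasWeakDerivWithinAt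

/-! ### Smoothness of matrix products, determinants and inverses. -/

section MatrixSmooth

variable {r : ℕ} {𝔼 : Type*} [NormedAddCommGroup 𝔼] [NormedSpace ℝ 𝔼] {Ω : Set 𝔼}

theorem contDiffOn_matrix_mul {M N : 𝔼 → Matrix (Fin r) (Fin r) ℂ}
    (hM : ∀ α β, ContDiffOn ℝ ∞ (fun p ↦ M p α β) Ω)
    (hN : ∀ α β, ContDiffOn ℝ ∞ (fun p ↦ N p α β) Ω) (α β : Fin r) :
    ContDiffOn ℝ ∞ (fun p ↦ (M p * N p) α β) Ω := by
  simp only [Matrix.mul_apply]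
  exact ContDiffOn.sum fun γ _ ↦ (hM α γ).mul (hN γ β)

theorem contDiffOn_matrix_det {M : 𝔼 → Matrix (Fin r) (Fin r) ℂ}
    (hM : ∀ α β, ContDiffOn ℝ ∞ (fun p ↦ M p α β) Ω) :
    ContDiffOn ℝ ∞ (fun p ↦ (M p).det) Ω := by
  simp only [Matrix.det_apply']
  exact ContDiffOn.sum fun σ _ ↦ contDiffOn_const.mul (contDiffOn_prod fun i _ ↦ hM _ _)

/-- Cramer's rule: the entries are determinants built from `M`, divided by the nonvanishing `det M`.
-/
theorem contDiffOn_matrix_inv {M : 𝔼 → Matrix (Fin r) (Fin r) ℂ}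
    (hM : ∀ α β, ContDiffOn ℝ ∞ (fun p ↦ M p α β) Ω) (hdet : ∀ p ∈ Ω, IsUnit (M p).det)
    (α β : Fin r) : ContDiffOn ℝ ∞ (fun p ↦ (M p)⁻¹ α β) Ω := by
  simp only [Matrix.inv_def, Matrix.smul_apply, smul_eq_mul, Ring.inverse_eq_inv',
    Matrix.adjugate_apply]
  refine ((contDiffOn_matrix_det hM).inv fun p hp ↦ (hdet p hp).ne_zero).mul
    (contDiffOn_matrix_det fun γ δ ↦ ?_)
  simp only [Matrix.updateRow_apply]
  split_ifs
  · exact contDiffOn_const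
  · exact hM γ δ

end MatrixSmooth

/-! ### First variation of the Chern connection and of its curvature. -/

section Variation

variable {n r : ℕ} {S : Set ℝ} {U : Set (Cn n)} {t : ℝ} {z : Cn n}
  {G B : ℝ → Cn n → Matrix (Fin r) (Fin r) ℂ}

/-- Differentiate `M M⁻¹ = 1` and solve for `Y`. Differentiability of the inverse is an input here;
Cramer's rule supplies it in the application. -/
theorem hasWeakDerivWithinAt_inv {M : ℝ → Matrix (Fin r) (Fin r) ℂ}
    {M' Y : Matrix (Fin r) (Fin r) ℂ} (ht : t ∈ S) (hS : UniqueDiffWithinAt ℝ S t)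
    (hdet : ∀ s ∈ S, IsUnit (M s).det) (hM : HasWeakDerivWithinAt M M' S t)
    (hY : HasWeakDerivWithinAt (fun s ↦ (M s)⁻¹) Y S t) : Y = -((M t)⁻¹ * M' * (M t)⁻¹) := by
  have h0 : M' * (M t)⁻¹ + M t * Y = 0 := by
    ext α β
    have h1 := (hM.mul hY).entry α β
    have h2 : HasDerivWithinAt (fun s ↦ (M s * (M s)⁻¹) α β) 0 S t :=
      (hasDerivWithinAt_const t S ((1 : Matrix (Fin r) (Fin r) ℂ) α β)).congr_of_mem
        (fun s hs ↦ by rw [Matrix.mul_nonsing_inv _ (hdet s hs)]) ht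
    exact hS.eq_deriv _ h1 h2
  have h3 := congrArg ((M t)⁻¹ * ·) (eq_neg_of_add_eq_zero_right h0)
  simp only [← mul_assoc, Matrix.nonsing_inv_mul _ (hdet t ht), one_mul, mul_neg] at h3
  exact h3

/-- Since `B = Ġ G⁻¹`, `B` inherits smoothness from `G`. Along the flow this avoids examining the
regularity of the moment map itself. -/
theorem contDiffOn_logDeriv (hS : UniqueDiffOn ℝ S) (hU : IsOpen U)
    (hG : ∀ α β, ContDiffOn ℝ ∞ (fun p : ℝ × Cn n ↦ G p.1 p.2 α β) (S ×ˢ U))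
    (hdet : ∀ s ∈ S, ∀ w ∈ U, IsUnit (G s w).det)
    (hGB : ∀ s ∈ S, ∀ w ∈ U, ∀ α β,
      HasDerivWithinAt (fun s ↦ G s w α β) ((B s w * G s w) α β) S s) (α β : Fin r) :
    ContDiffOn ℝ ∞ (fun p : ℝ × Cn n ↦ B p.1 p.2 α β) (S ×ˢ U) := by
  have hBG : ∀ α β, ContDiffOn ℝ ∞ (fun p : ℝ × Cn n ↦ (B p.1 p.2 * G p.1 p.2) α β) (S ×ˢ U) :=
    fun α β ↦ (contDiffOn_fderivWithin_apply hS hU (hG α β) (1, 0)).congr fun p hp ↦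
      (hS p.1 hp.1).eq_deriv _ (hGB p.1 hp.1 p.2 hp.2 α β)
        (hasDerivWithinAt_time hp.2 ((hG α β).differentiableOn (by simp) p hp))
  refine (contDiffOn_matrix_mul hBG
    (contDiffOn_matrix_inv hG fun p hp ↦ hdet p.1 hp.1 p.2 hp.2) α β).congr fun p hp ↦ ?_
  rw [Matrix.mul_nonsing_inv_cancel_right _ _ (hdet p.1 hp.1 p.2 hp.2)]

theorem differentiableAt_space {f : ℝ × Cn n → ℂ} (hU : IsOpen U)
    (hf : ContDiffOn ℝ ∞ f (S ×ˢ U)) (ht : t ∈ S) (hz : z ∈ U) :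
    DifferentiableAt ℝ (fun w ↦ f (t, w)) z := by
  have h := hf.comp (f := fun w : Cn n ↦ (t, w)) (s := U)
    (contDiff_const.prodMk contDiff_id).contDiffOn fun w hw ↦ ⟨ht, hw⟩
  exact (h.contDiffAt (hU.mem_nhds hz)).differentiableAt (by simp)

theorem contDiffOn_connCoeff (hS : UniqueDiffOn ℝ S) (hU : IsOpen U)
    (hG : ∀ α β, ContDiffOn ℝ ∞ (fun p : ℝ × Cn n ↦ G p.1 p.2 α β) (S ×ˢ U))
    (hdet : ∀ s ∈ S, ∀ w ∈ U, IsUnit (G s w).det) (j : Fin n) (α β : Fin r) :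
    ContDiffOn ℝ ∞ (fun p : ℝ × Cn n ↦ connCoeff (G p.1) j p.2 α β) (S ×ˢ U) :=
  contDiffOn_matrix_mul (fun α β ↦ contDiffOn_wirt hS hU (hG α β) j)
    (contDiffOn_matrix_inv hG fun p hp ↦ hdet p.1 hp.1 p.2 hp.2) α β

/-- The variation of the Chern connection: `(∂H H⁻¹)˙ = ∂_H (Ḣ H⁻¹)`. -/
theorem hasDerivWithinAt_connCoeff (hS : UniqueDiffOn ℝ S) (hS' : S ⊆ closure (interior S))
    (hU : IsOpen U)
    (hG : ∀ α β, ContDiffOn ℝ ∞ (fun p : ℝ × Cn n ↦ G p.1 p.2 α β) (S ×ˢ U))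
    (hdet : ∀ s ∈ S, ∀ w ∈ U, IsUnit (G s w).det)
    (hGB : ∀ s ∈ S, ∀ w ∈ U, ∀ α β,
      HasDerivWithinAt (fun s ↦ G s w α β) ((B s w * G s w) α β) S s)
    (ht : t ∈ S) (hz : z ∈ U) (j : Fin n) (α β : Fin r) :
    HasDerivWithinAt (fun s ↦ connCoeff (G s) j z α β) (covDerivCoeff (G t) (B t) j z α β) S t := by
  have hB := contDiffOn_logDeriv hS hU hG hdet hGB
  have hGd : HasWeakDerivWithinAt (fun s ↦ G s z) (B t z * G t z) S t :=
    .matrix fun α β ↦ .of_hasDerivWithinAt (hGB t ht z hz α β)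
  have hYd : HasWeakDerivWithinAt (fun s ↦ (G s z)⁻¹)
      (-((G t z)⁻¹ * (B t z * G t z) * (G t z)⁻¹)) S t := by
    have hY : HasWeakDerivWithinAt (fun s ↦ (G s z)⁻¹) (Matrix.of fun α β ↦
        fderivWithin ℝ (fun p : ℝ × Cn n ↦ (G p.1 p.2)⁻¹ α β) (S ×ˢ U) (t, z) (1, 0)) S t :=
      .matrix fun α β ↦ .of_hasDerivWithinAt <| hasDerivWithinAt_time hz
        ((contDiffOn_matrix_inv hG fun p hp ↦ hdet p.1 hp.1 p.2 hp.2) α β |>.differentiableOn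
          (by simp) _ ⟨ht, hz⟩)
    rwa [hasWeakDerivWithinAt_inv ht (hS t ht) (fun s hs ↦ hdet s hs z hz) hGd hY] at hY
  have hWd : HasWeakDerivWithinAt (fun s ↦ Matrix.of fun α β ↦ wirt j (fun w ↦ G s w α β) z)
      (Matrix.of fun α β ↦ wirt j (fun w ↦ (B t w * G t w) α β) z) S t :=
    .matrix fun α β ↦ .of_hasDerivWithinAt <| hasDerivWithinAt_wirt
      (f := fun p ↦ G p.1 p.2 α β) (f' := fun p ↦ (B p.1 p.2 * G p.1 p.2) α β) hS hS' hU (hG α β)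
      (fun s hs w hw ↦ hGB s hs w hw α β) ht hz j
  have hprod : (Matrix.of fun α β ↦ wirt j (fun w ↦ (B t w * G t w) α β) z) =
      (Matrix.of fun α β ↦ wirt j (fun w ↦ B t w α β) z) * G t z +
        B t z * Matrix.of fun α β ↦ wirt j (fun w ↦ G t w α β) z := by
    ext α β
    simp only [Matrix.of_apply, Matrix.add_apply, Matrix.mul_apply, ← Finset.sum_add_distrib]
    exact wirt_sum_mul (fun γ ↦ differentiableAt_space hU (hB α γ) ht hz)
      (fun γ ↦ differentiableAt_space hU (hG γ β) ht hz) j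
  refine ((hWd.mul hYd).entry α β).congr_deriv ?_
  -- With `A = ∂G G⁻¹`, the claim is `(∂B G + B ∂G) G⁻¹ - ∂G G⁻¹ (B G) G⁻¹ = ∂B + B A - A B`.
  refine congrArg (fun M : Matrix (Fin r) (Fin r) ℂ ↦ M α β) ?_
  have hu := hdet t ht z hz
  rw [hprod, covDerivCoeff, connCoeff, add_mul, Matrix.mul_nonsing_inv_cancel_right _ _ hu,
    ← mul_assoc, Matrix.mul_nonsing_inv_cancel_right _ _ hu, mul_neg, ← sub_eq_add_neg]
  simp only [mul_assoc]

/-- The variation of the curvature: `Ḟ = ∂̄ ∂_H (Ḣ H⁻¹)`. -/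
theorem hasWeakDerivWithinAt_curvature (hS : UniqueDiffOn ℝ S) (hS' : S ⊆ closure (interior S))
    (hU : IsOpen U)
    (hG : ∀ α β, ContDiffOn ℝ ∞ (fun p : ℝ × Cn n ↦ G p.1 p.2 α β) (S ×ˢ U))
    (hdet : ∀ s ∈ S, ∀ w ∈ U, IsUnit (G s w).det)
    (hGB : ∀ s ∈ S, ∀ w ∈ U, ∀ α β,
      HasDerivWithinAt (fun s ↦ G s w α β) ((B s w * G s w) α β) S s)
    (ht : t ∈ S) (hz : z ∈ U) :
    HasWeakDerivWithinAt (fun s ↦ curvature (G s) z) (dbarDH (G t) (B t) z) S t :=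
  .matrix fun α β ↦ by
    simp only [curvature, dbarDH, Matrix.of_apply]
    exact .sum fun j _ ↦ .sum fun k _ ↦ .smul_const (hasDerivWithinAt_wirtBar (f := fun p ↦ connCoeff (G p.1) j p.2 α β)
      (f' := fun p ↦ covDerivCoeff (G p.1) (B p.1) j p.2 α β) hS hS' hU
      (contDiffOn_connCoeff hS hU hG hdet j α β)
      (fun _ hs _ hw ↦ hasDerivWithinAt_connCoeff hS hS' hU hG hdet hGB hs hw j α β) ht hz k) _

/-- A constant multiple of `I` has zero derivative and commutes with the connection matrix, so the
Euler characteristic term of the flow disappears at this point. -/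
theorem dbarDH_neg_add_scalar (K Φ : Cn n → Matrix (Fin r) (Fin r) ℂ) (a : ℂ) (z : Cn n) :
    dbarDH K (fun w ↦ -Φ w + a • (1 : Matrix (Fin r) (Fin r) ℂ)) z = -dbarDH K Φ z := by
  have h : ∀ j w, covDerivCoeff K (fun w ↦ -Φ w + a • (1 : Matrix (Fin r) (Fin r) ℂ)) j w =
      -covDerivCoeff K Φ j w := by
    intro j w
    have hw : (Matrix.of fun α β ↦
        wirt j (fun w ↦ (-Φ w + a • (1 : Matrix (Fin r) (Fin r) ℂ)) α β) w) =
        -Matrix.of fun α β ↦ wirt j (fun w ↦ Φ w α β) w := by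
      ext α β
      simp only [Matrix.of_apply, Matrix.add_apply, Matrix.neg_apply, wirt_add_const, wirt_neg]
    simp only [covDerivCoeff, hw, add_mul, mul_add, neg_mul, mul_neg, smul_mul_assoc,
      mul_smul_comm, one_mul, mul_one]
    abel
  ext α β
  simp only [dbarDH, h, Matrix.neg_apply, wirtBar_neg, neg_smul, Finset.sum_neg_distrib,
    Matrix.of_apply]

end Variation

/-! ### Invertibility of Gram matrices in local frames. -/

section Frames

theorem isOpen_dom {n r : ℕ} {X : Type*} [TopologicalSpace X] {E : X → Type*}
    [TopologicalSpace (TotalSpace (Cn r) E)] (c : OpenPartialHomeomorph X (Cn n))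
    (τ : Trivialization (Cn r) (π (Cn r) E)) : IsOpen (dom c τ) :=
  c.symm.isOpen_inter_preimage τ.open_baseSet

variable {n r : ℕ} {X : Type*} [TopologicalSpace X] [ChartedSpace (Cn n) X]
  {E : X → Type*} [∀ x, AddCommGroup (E x)] [∀ x, Module ℂ (E x)]
  [∀ x, TopologicalSpace (E x)] [TopologicalSpace (TotalSpace (Cn r) E)] [FiberBundle (Cn r) E]
  [VectorBundle ℂ (Cn r) E]

theorem sum_smul_frame (τ : Trivialization (Cn r) (π (Cn r) E)) [MemTrivializationAtlas τ]
    {x : X} (hx : x ∈ τ.baseSet) (v : Fin r → ℂ) : ∑ α, v α • frame τ x α = τ.symmₗ ℂ x v := by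
  have h : v = ∑ α, v α • (Pi.single α 1 : Fin r → ℂ) := by
    ext β
    simp [Pi.single_apply]
  have h' := congrArg (τ.symmₗ ℂ x) h
  rw [map_sum] at h'
  rw [h']
  refine Finset.sum_congr rfl fun α _ ↦ ?_
  rw [map_smul, τ.coe_symmₗ hx]
  rfl

/-- The matrix of a Hermitian metric in a local frame is invertible. -/
theorem isUnit_det_gram (K : HermitianMetric n r E) (c : OpenPartialHomeomorph X (Cn n))
    (τ : Trivialization (Cn r) (π (Cn r) E)) [MemTrivializationAtlas τ] {z : Cn n}
    (hz : z ∈ dom c τ) : IsUnit (gram K.inner c τ z).det := by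
  rw [isUnit_iff_ne_zero]
  intro hdet
  -- A null row vector `v` yields the nonzero vector `u = ∑ v_α e_α` with `⟨u, u⟩ = ∑ v_α H_{αβ}
  -- v̄_β = 0`, against positivity.
  obtain ⟨v, hv, hv0⟩ := Matrix.exists_vecMul_eq_zero_iff.2 hdet
  set x := c.symm z
  have hx : x ∈ τ.baseSet := hz.2
  have hu : τ.symmₗ ℂ x v ≠ 0 := by
    intro h
    refine hv ?_
    have := τ.linearMapAt_symmₗ (R := ℂ) hx v
    rw [h, map_zero] at this
    exact this.symm
  have hpos := K.pos x _ hu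
  have h0 : K.inner x (τ.symmₗ ℂ x v) (τ.symmₗ ℂ x v) = 0 := by
    rw [← sum_smul_frame τ hx]
    simp only [map_sum, LinearMap.sum_apply, map_smulₛₗ, LinearMap.smul_apply, Finset.smul_sum]
    rw [Finset.sum_comm]
    refine Finset.sum_eq_zero fun β _ ↦ ?_
    have := congrFun hv0 β
    simp only [Matrix.vecMul, dotProduct, gram, Matrix.of_apply, Pi.zero_apply] at this
    simp only [RingHom.id_apply, smul_eq_mul, mul_left_comm _ ((starRingEnd ℂ) (v β))]
    rw [← Finset.mul_sum, this, mul_zero]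
  rw [h0] at hpos
  simp at hpos

end Frames

/-! ### The Kähler form as a central `2`-form, and the flow written in a frame. -/

theorem kahlerForm_mem {n : ℕ} {X : Type*} [TopologicalSpace X] [ChartedSpace (Cn n) X]
    [IsManifold 𝓘(ℂ, Cn n) 1 X] (g : HermitianMetric n n (Tan n X))
    (c : OpenPartialHomeomorph X (Cn n)) (z : Cn n) :
    kahlerForm g c z ∈ ⋀[ℂ]^2 (Cotangent (Cn n)) :=
  Submodule.sum_mem _ fun j _ ↦ Submodule.sum_mem _ fun k _ ↦
    Submodule.smul_mem _ _ (dz_mul_dzbar_mem j k)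

theorem kahlerForm_commute {n : ℕ} {X : Type*} [TopologicalSpace X] [ChartedSpace (Cn n) X]
    [IsManifold 𝓘(ℂ, Cn n) 1 X] (g : HermitianMetric n n (Tan n X))
    (c : OpenPartialHomeomorph X (Cn n)) (z : Cn n) (b : Form (Cn n)) :
    Commute (kahlerForm g c z) b :=
  Commute.sum_left _ _ _ fun _ _ ↦ Commute.sum_left _ _ _ fun _ _ ↦
    (ι_mul_ι_mul_comm _ _ b).smul_left _

/-- Along the flow, `Ḣ = (-(n!/ωⁿ) μ + χ(X, E ⊗ L^k) / rk(E) I) H` in a holomorphic frame. -/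
theorem IsAHEFlow.hasDerivWithinAt_gram {n r k : ℕ} {X : Type*} [TopologicalSpace X]
    [ChartedSpace (Cn n) X] [IsManifold 𝓘(ℂ, Cn n) 1 X]
    {E : X → Type*} [∀ x, AddCommGroup (E x)] [∀ x, Module ℂ (E x)]
    [∀ x, TopologicalSpace (E x)] [TopologicalSpace (TotalSpace (Cn r) E)]
    [FiberBundle (Cn r) E] [VectorBundle ℂ (Cn r) E]
    {L : X → Type*} [∀ x, AddCommGroup (L x)] [∀ x, Module ℂ (L x)]
    [∀ x, TopologicalSpace (L x)] [TopologicalSpace (TotalSpace (Cn 1) L)]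
    [FiberBundle (Cn 1) L] [VectorBundle ℂ (Cn 1) L]
    {g : HermitianMetric n n (Tan n X)} {Td : FormField n X}
    {T : ℝ} {H₀ : HermitianMetric n r E} {H : ℝ → HermitianMetric n r E}
    (hH : IsAHEFlow L k g Td T H₀ H) {c : OpenPartialHomeomorph X (Cn n)}
    (hc : c ∈ atlas (Cn n) X) (τ : Trivialization (Cn r) (π (Cn r) E)) [MemTrivializationAtlas τ]
    {z : Cn n} (hz : z ∈ dom c τ) {t : ℝ} (ht : t ∈ Set.Ico 0 T) (α β : Fin r) :
    HasDerivWithinAt (fun s ↦ gram (H s).inner c τ z α β)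
      (((-momentDensity k (kahlerForm g c) (volForm g c) (inChart c Td)
              (gram (H t).inner c τ) z +
            ((eulerChar n r E L k : ℂ) / (r : ℂ)) • (1 : Matrix (Fin r) (Fin r) ℂ)) *
          gram (H t).inner c τ z) α β) (Set.Ico 0 T) t := by
  obtain ⟨h', hd, he⟩ := hH.flow c hc τ z hz t ht
  have h0 := isUnit_det_gram H₀ c τ hz
  have hX : IsUnit (gram (H t).inner c τ z * (gram H₀.inner c τ z)⁻¹).det := by
    rw [Matrix.det_mul]
    exact (isUnit_det_gram (H t) c τ hz).mul (Matrix.isUnit_nonsing_inv_det _ h0)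
  have hw : HasWeakDerivWithinAt
      (fun s ↦ gram (H s).inner c τ z * (gram H₀.inner c τ z)⁻¹) h' (Set.Ico 0 T) t :=
    .matrix fun α β ↦ .of_hasDerivWithinAt (hd α β)
  -- `H₀` is independent of time, so right multiplication by it recovers `Ḣ` from `ḣ`.
  have hw' := (hw.map (LinearMap.mulRight ℂ (gram H₀.inner c τ z))).entry α β
  simp only [LinearMap.mulRight_apply, Matrix.nonsing_inv_mul_cancel_right _ _ h0] at hw'
  rw [← he]
  refine hw'.congr_deriv (congrArg (fun M : Matrix (Fin r) (Fin r) ℂ ↦ M α β) ?_)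
  generalize gram (H t).inner c τ z = Gt at hX
  generalize gram H₀.inner c τ z = G₀ at h0 hX
  calc h' * G₀ = h' * (Gt * G₀⁻¹)⁻¹ * (Gt * G₀⁻¹) * G₀ := by
        rw [Matrix.nonsing_inv_mul_cancel_right _ _ hX]
    _ = h' * (Gt * G₀⁻¹)⁻¹ * Gt := by
        rw [mul_assoc, Matrix.nonsing_inv_mul_cancel_right _ _ h0]

end AHE

/-- The identity is local, hence checked on matrix entries in every chart and holomorphic frame.
Forms at a point make up a finite-dimensional space, so testing on every functional `l` determines
the derivative; within `[0, T)` it is one-sided at `0`. -/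
theorem theorem2 {n r k : ℕ} {X : Type*} [TopologicalSpace X] [T2Space X] [CompactSpace X]
    [ChartedSpace (AHE.Cn n) X] [IsManifold 𝓘(ℂ, AHE.Cn n) ω X]
    {E : X → Type*} [∀ x, AddCommGroup (E x)] [∀ x, Module ℂ (E x)]
    [∀ x, TopologicalSpace (E x)] [TopologicalSpace (TotalSpace (AHE.Cn r) E)]
    [FiberBundle (AHE.Cn r) E] [VectorBundle ℂ (AHE.Cn r) E]
    [ContMDiffVectorBundle ω (AHE.Cn r) E 𝓘(ℂ, AHE.Cn n)]
    {L : X → Type*} [∀ x, AddCommGroup (L x)] [∀ x, Module ℂ (L x)]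
    [∀ x, TopologicalSpace (L x)] [TopologicalSpace (TotalSpace (AHE.Cn 1) L)]
    [FiberBundle (AHE.Cn 1) L] [VectorBundle ℂ (AHE.Cn 1) L]
    [ContMDiffVectorBundle ω (AHE.Cn 1) L 𝓘(ℂ, AHE.Cn n)]
    (g : AHE.HermitianMetric n n (AHE.Tan n X)) (hg : AHE.IsKahler g)
    (hL : AHE.ChernClassEq L g)
    (Td : AHE.FormField n X) (hTd : AHE.IsHarmonicTodd g Td)
    (T : ℝ) (H₀ : AHE.HermitianMetric n r E) (H : ℝ → AHE.HermitianMetric n r E)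
    (hH : AHE.IsAHEFlow L k g Td T H₀ H) :
    ∀ c ∈ atlas (AHE.Cn n) X,
      ∀ (τ : Trivialization (AHE.Cn r) (π (AHE.Cn r) E)) [MemTrivializationAtlas τ],
      ∀ z ∈ AHE.dom c τ, ∀ t ∈ Set.Ico 0 T, ∀ (α β : Fin r)
        (l : AHE.Form (AHE.Cn n) →ₗ[ℂ] ℂ),
        HasDerivWithinAt
          (fun s ↦ l (AHE.momentMap k (AHE.kahlerForm g c) (AHE.inChart c Td)
            (AHE.gram (H s).inner c τ) z α β))
          (l (AHE.evolutionRHS k (AHE.kahlerForm g c) (AHE.volForm g c) (AHE.inChart c Td)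
            (AHE.gram (H t).inner c τ) z α β))
          (Set.Ico 0 T) t := by
  intro c hc τ _ z hz t ht α β l
  have hT : (0 : ℝ) < T := ht.1.trans_lt ht.2
  have hS : UniqueDiffOn ℝ (Set.Ico 0 T) := uniqueDiffOn_Ico 0 T
  have hS' : Set.Ico 0 T ⊆ closure (interior (Set.Ico 0 T)) := by
    rw [interior_Ico, closure_Ioo hT.ne]
    exact Set.Ico_subset_Icc_self
  -- Here `B` is the right-hand side of the flow.
  have hcurv := AHE.hasWeakDerivWithinAt_curvature (G := fun s ↦ AHE.gram (H s).inner c τ)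
    hS hS' (AHE.isOpen_dom c τ)
    (fun α β ↦ hH.smooth c hc τ α β) (fun s _ w hw ↦ AHE.isUnit_det_gram (H s) c τ hw)
    (fun s hs w hw α β ↦ hH.hasDerivWithinAt_gram hc τ hw hs α β) ht hz
  have hder := AHE.hasWeakDerivWithinAt_exp_degreePart
    ((AHE.isHomogeneousMatrix_curvature (AHE.gram (H t).inner c τ) z).smul _)
    ((AHE.isHomogeneousMatrix_dbarDH _ _ z).smul _)
    (hcurv.const_smul (Complex.I / (2 * (Real.pi : ℂ))))
    (AHE.kahlerForm_mem g c z) (AHE.kahlerForm_commute g c z) k (AHE.inChart c Td z)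
  refine (hder (l ∘ₗ (Matrix.entryLinearMap ℂ (AHE.Form (AHE.Cn n)) α β :
    Matrix (Fin r) (Fin r) (AHE.Form (AHE.Cn n)) →ₗ[ℂ] AHE.Form (AHE.Cn n)))).congr_deriv ?_
  rw [LinearMap.comp_apply, Matrix.entryLinearMap_apply]
  refine congrArg (fun M : Matrix (Fin r) (Fin r) (AHE.Form (AHE.Cn n)) ↦ l (M α β)) ?_
  rw [AHE.evolutionRHS, ← Finset.sum_neg_distrib]
  refine Finset.sum_congr rfl fun m _ ↦ ?_
  rw [← Finset.sum_neg_distrib]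
  refine Finset.sum_congr rfl fun i _ ↦ ?_
  -- The symmetrized product is linear in its distinguished factor, so the sign and the scalar
  -- `i/2π` come out of it.
  rw [AHE.dbarDH_neg_add_scalar, AHE.symProd_snoc_const, AHE.symProd_snoc_const]
  simp only [smul_neg, mul_neg, neg_mul, mul_smul_comm, smul_mul_assoc, ← Finset.smul_sum,
    Finset.sum_neg_distrib, smul_smul, AHE.chernForm]
  congr 2
  ring
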